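/- Let $\mathrm{Diff}(\mathbb C^2,0)$ be the group, under composition, of germs at the origin of holomorphic diffeomorphisms of $\mathbb C^2$ fixing $0$, and let $\mathrm{Diff}_1(\mathbb C^2,0)$ be its subgroup of germs tangent to the identity (derivative at $0$ equal to the identity). Given local holomorphic diffeomorphisms $h_1,\dots,h_k$ fixing $0$ and an open neighbourhood $V$ of $0$ on which all $h_i^{\pm1}$ are defined and one-to-one, the pseudogroup they generate on $V$ consists of the compositions $F=F_s\circ\cdots\circ F_1$ with $F_j\in\{h_i^{\pm1}\}$; the domain $\mathrm{Dom}_V(F)$ is the set of $x\in V$ with $F_l\circ\cdots\circ F_1(x)\in V$ for all $1\le l<s$ (the empty composition is the identity of $V$). The orbit of $p\in V$ is the set of points of $V$ of the form $F(p)$ with $p\in\mathrm{Dom}_V(F)$. It is locally discrete if every point $q$ of the orbit has a neighbourhood $W$ whose intersection with the orbit is $\{q\}$. A finitely generated group $G$ of germs has locally discrete orbits if, for some choice of local diffeomorphisms $h_1,\dots,h_k$ whose germs generate $G$ and some $V$ as above, the orbit of every $p\in V$ is locally discrete. Proposition. Let $G\subset\mathrm{Diff}_1(\mathbb C^2,0)$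 be a finitely generated group. (1) If $G$ has locally discrete orbits, then $G$ is solvable. (2) If $G$ is not solvable, then for every choice of local diffeomorphisms $h_1,\dots,h_k$ whose germs generate $G$ and every $V$ as above there is $\epsilon>0$ such that: (a) the pseudogroup on $V$ contains a sequence of elements $F_n$, all defined on the ball $B_\epsilon$ of radius $\epsilon$ about $0$ (i.e. $B_\epsilon\subset\mathrm{Dom}_V(F_n)$), whose germs at $0$ are different from the identity and which converge to the identity uniformly on $B_\epsilon$; and (b) some point $p\in B_\epsilon$ has an orbit in $V$ that is not locally discrete. -/

import Mathlib

open Filter Topology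

noncomputable section

namespace LocalDyn

variable (E : Type*) [NormedAddCommGroup E] [NormedSpace ℂ E]

/-- Self-maps of `E` that fix the origin and are holomorphic on a neighbourhood of it, a monoid
under composition. -/
def holFixing : Submonoid (Function.End E) where
  carrier := {f | AnalyticAt ℂ (f : E → E) 0 ∧ (f : E → E) 0 = 0}
  one_mem' := ⟨analyticAt_id, rfl⟩
  mul_mem' := by
    rintro f g ⟨hf, hf0⟩ ⟨hg, hg0⟩
    refine ⟨?_, ?_⟩
    · exact AnalyticAt.fun_comp (f := (g : E → E)) (g := (f : E → E)) (by rw [hg0]; exact hf) hg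
    · change (f : E → E) ((g : E → E) 0) = 0
      rw [hg0, hf0]

/-- Two such maps are identified when they agree on a neighbourhood of the origin. -/
def germCon : Con (holFixing E) where
  r f g := (f.1 : E → E) =ᶠ[𝓝 0] (g.1 : E → E)
  iseqv := ⟨fun _ => EventuallyEq.rfl, fun h => h.symm, fun h k => h.trans k⟩
  mul' := by
    intro f f' g g' hf hg
    have ht : Tendsto (g.1 : E → E) (𝓝 0) (𝓝 0) := by
      have := g.2.1.continuousAt.tendsto
      rwa [g.2.2] at this
    filter_upwards [hg, ht.eventually hf] with x hx hfx
    change (f.1 : E → E) ((g.1 : E → E) x) = (f'.1 : E → E) ((g'.1 : E → E) x)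
    rw [hfx, hx]

/-- The monoid of germs at `0` of holomorphic maps `(E, 0) → (E, 0)` under composition. -/
abbrev HolGerm := (germCon E).Quotient

/-- The group `Diff(E, 0)` of germs at `0` of holomorphic diffeomorphisms fixing `0`: the germs
of holomorphic maps which are invertible under composition. -/
abbrev DiffGerm := (HolGerm E)ˣ

/-- The derivative at the origin, as a homomorphism on germs. -/
def derivHom : HolGerm E →* (E →L[ℂ] E) :=
  (germCon E).lift
    { toFun := fun f => fderiv ℂ (f.1 : E → E) 0
      map_one' := fderiv_id
      map_mul' := by
        intro f g
        have hg := g.2.1.differentiableAt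
        have hf : DifferentiableAt ℂ (f.1 : E → E) ((g.1 : E → E) 0) := by
          rw [g.2.2]; exact f.2.1.differentiableAt
        have := fderiv_comp (0 : E) hf hg
        rw [g.2.2] at this
        exact this }
    (fun _ _ h => EventuallyEq.fderiv_eq h)

/-- The group `Diff₁(E, 0)` of germs of holomorphic diffeomorphisms tangent to the identity. -/
def tangentToId : Subgroup (DiffGerm E) := (Units.map (derivHom E)).ker

/-- A holomorphic diffeomorphism between two open neighbourhoods (`source` and `target`) of the
origin, fixing the origin. -/
structure LocalDiffeo extends OpenPartialHomeomorph E E where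
  zero_mem : (0 : E) ∈ source
  map_zero : toFun 0 = 0
  holo : AnalyticOnNhd ℂ toFun source
  holo_symm : AnalyticOnNhd ℂ invFun target

variable {E}

namespace LocalDiffeo

theorem zero_mem_target (h : LocalDiffeo E) : (0 : E) ∈ h.target := by
  have := h.map_source' h.zero_mem
  rwa [h.map_zero] at this

theorem inv_zero (h : LocalDiffeo E) : h.invFun 0 = 0 := by
  have := h.left_inv' h.zero_mem
  rwa [h.map_zero] at this

/-- The germ at the origin of a local diffeomorphism. -/
def germ (h : LocalDiffeo E) : DiffGerm E where
  val := ((⟨h.toFun, h.holo 0 h.zero_mem, h.map_zero⟩ : holFixing E) : HolGerm E)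
  inv := ((⟨h.invFun, h.holo_symm 0 h.zero_mem_target, h.inv_zero⟩ : holFixing E) : HolGerm E)
  val_inv := by
    refine (Con.eq (germCon E)).2 ?_
    filter_upwards [h.open_target.mem_nhds h.zero_mem_target] with x hx
    exact h.right_inv' hx
  inv_val := by
    refine (Con.eq (germCon E)).2 ?_
    filter_upwards [h.open_source.mem_nhds h.zero_mem] with x hx
    exact h.left_inv' hx

end LocalDiffeo

variable (E)

/-- Generators `h₁, …, h_k` of a pseudogroup (actual local diffeomorphisms, not germs) together
with an open neighbourhood `V` of the origin on which all `hᵢ` and all `hᵢ⁻¹` are defined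
(and hence injective). -/
structure Pseudogroup where
  k : ℕ
  gen : Fin k → LocalDiffeo E
  V : Set E
  isOpen_V : IsOpen V
  zero_mem : (0 : E) ∈ V
  subset_source : ∀ i, V ⊆ (gen i).source
  subset_target : ∀ i, V ⊆ (gen i).target

variable {E}

namespace Pseudogroup

variable (P : Pseudogroup E)

/-- The group of germs generated by the germs of `h₁, …, h_k`. -/
def group : Subgroup (DiffGerm E) := Subgroup.closure (Set.range fun i => (P.gen i).germ)

/-- A letter `(i, true)` stands for `hᵢ` and `(i, false)` for `hᵢ⁻¹`. -/
def letter (a : Fin P.k × Bool) : E → E :=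
  if a.2 then (P.gen a.1).toFun else (P.gen a.1).invFun

/-- The map `F_s ∘ ⋯ ∘ F₁` attached to the word `[F_s, …, F₁]`. -/
def wordMap : List (Fin P.k × Bool) → E → E
  | [], x => x
  | a :: w, x => P.letter a (wordMap w x)

/-- The domain of `F_s ∘ ⋯ ∘ F₁` as an element of the pseudogroup: the points `x ∈ V` with
`F_l ∘ ⋯ ∘ F₁ (x) ∈ V` for all `1 ≤ l < s`. -/
def dom : List (Fin P.k × Bool) → Set E
  | [] => P.V
  | _ :: w => {x | x ∈ dom w ∧ P.wordMap w x ∈ P.V}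

/-- The orbit of `p` in `V` under the pseudogroup. -/
def orbit (p : E) : Set E := {q | q ∈ P.V ∧ ∃ w, p ∈ P.dom w ∧ P.wordMap w p = q}

/-- The orbit of `p` is locally discrete: each of its points has a neighbourhood containing no
other point of the orbit. -/
def LocallyDiscreteAt (p : E) : Prop :=
  ∀ q ∈ P.orbit p, ∃ W ∈ 𝓝 q, W ∩ P.orbit p = {q}

end Pseudogroup

/-- A group `G` of germs has locally discrete orbits: it is generated by the germs of finitely many
local diffeomorphisms which, on some open neighbourhood `V` of the origin, generate a pseudogroup
all of whose orbits are locally discrete. -/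
def HasLocallyDiscreteOrbits (G : Subgroup (DiffGerm E)) : Prop :=
  ∃ P : Pseudogroup E, P.group = G ∧ ∀ p ∈ P.V, P.LocallyDiscreteAt p

end LocalDyn

end

/-!
If `f` and `g` are within `ε` of the identity on a ball, then on a slightly smaller ball their
commutator is within `O(ε ^ 2)` of it by Cauchy's estimate, and conjugating it boundedly often by
maps close to the identity costs only a constant factor. Starting from a set `S` of generators on a
small ball, on which they are as close to the identity as desired, one can therefore iterate the
passage to the conjugated commutators `conjCommutators S 8`, and obtains elements converging to the
identity on a fixed ball. If all orbits were locally discrete, every point of this ball would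
eventually be fixed, so by Baire one of these elements would be the identity on an open set, hence
everywhere. What remains is that the sets never become trivial: if `conjCommutators S 8` generates a
group of derived length at most `4`, then so does `S`.

Germs tangent to the identity act faithfully on formal power series by substitution, and an
automorphism tangent to the identity lies in a formal flow, whose generator, its logarithm, is a
derivation of the fraction field of the ring of power series. Conjugation of automorphisms is
conjugation of logarithms, and commuting automorphisms have commuting logarithms. A chain argument
along the derived series of the closures of `conjCommutators S n` gives subgroups `A 0 ≤ A 1 ≤ A 2`
with `A 0` nontrivial and `A 2` abelian, such that `S` conjugates each of them into the next one.
* If `A 1` contains two elements with linearly independent logarithms, these form a commuting frame.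
  As `S` conjugates it to fields commuting with it, hence to its constant linear combinations, the
  group acts linearly on the span of the frame; the action is unipotent, hence triangular, and the
  group is metabelian.
* Otherwise `S` preserves the direction of the logarithm of some `γ ≠ 1`, hence the field of first
  integrals of `γ`. The same chain argument modulo the elements fixing this field, on which
  derivations now act through a single direction, shows that the action on it is metabelian, and the
  elements fixing the first integrals form a metabelian group as well.
-/

noncomputable section

namespace LocalDyn

section IteratedCommutators

open scoped commutatorElement

variable {G G' : Type*} [Group G] [Group G'] {H N : Subgroup G} {S : Set G}

/-- The derived series of a subgroup `H`, as a sequence of subgroups of the ambient group, so that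
the terms attached to different `H` can be compared. -/
def iterCommutator (H : Subgroup G) : ℕ → Subgroup G
  | 0 => H
  | n + 1 => ⁅iterCommutator H n, iterCommutator H n⁆

theorem iterCommutator_mono {K : Subgroup G} (h : H ≤ K) (n : ℕ) :
    iterCommutator H n ≤ iterCommutator K n := by
  induction n with
  | zero => exact h
  | succ n ih => exact Subgroup.commutator_mono ih ih

theorem iterCommutator_antitone (H : Subgroup G) : Antitone (iterCommutator H) :=
  antitone_nat_of_succ_le fun _ => Subgroup.commutator_le_self _

theorem iterCommutator_add (H : Subgroup G) (m n : ℕ) :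
    iterCommutator H (m + n) = iterCommutator (iterCommutator H m) n := by
  induction n with
  | zero => rfl
  | succ n ih => rw [← add_assoc, iterCommutator, iterCommutator, ih]

theorem map_iterCommutator (f : G →* G') (H : Subgroup G) (n : ℕ) :
    (iterCommutator H n).map f = iterCommutator (H.map f) n := by
  induction n with
  | zero => rfl
  | succ n ih => rw [iterCommutator, Subgroup.map_commutator, ih, iterCommutator]

theorem isSolvable_of_iterCommutator_eq_bot {n : ℕ} (h : iterCommutator H n = ⊥) :
    Group.IsSolvable H := by
  have map_derivedSeries : ∀ n, (derivedSeries H n).map H.subtype = iterCommutator H n := by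
    intro n
    induction n with
    | zero =>
      rw [derivedSeries_zero, ← MonoidHom.range_eq_map, Subgroup.range_subtype, iterCommutator]
    | succ n ih => rw [derivedSeries_succ, Subgroup.map_commutator, ih, iterCommutator]
  refine ⟨n, ?_⟩
  rw [← Subgroup.map_eq_bot_iff_of_injective _ H.subtype_injective, map_derivedSeries, h]

/-- The commutators of elements of `S`, together with their conjugates by products of at most `n`
elements of `S`. -/
def conjCommutators (S : Set G) : ℕ → Set G
  | 0 => Set.image2 (fun s t => ⁅s, t⁆) S S
  | n + 1 => conjCommutators S n ∪ Set.image2 (fun s x => s * x * s⁻¹) S (conjCommutators S n)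

theorem image_conjCommutators (f : G →* G') (S : Set G) (n : ℕ) :
    f '' conjCommutators S n = conjCommutators (f '' S) n := by
  induction n with
  | zero => exact Set.image_image2_distrib fun s t => map_commutatorElement f s t
  | succ n ih =>
    rw [conjCommutators, conjCommutators, Set.image_union, ← ih]
    congr 1
    exact Set.image_image2_distrib fun s x => by simp only [map_mul, map_inv]

theorem conjCommutators_subset_closure (S : Set G) (n : ℕ) :
    conjCommutators S n ⊆ Subgroup.closure S := by
  have hS : ∀ s ∈ S, s ∈ Subgroup.closure S := fun s hs => Subgroup.subset_closure hs
  induction n with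
  | zero =>
    rintro _ ⟨s, hs, t, ht, rfl⟩
    exact mul_mem (mul_mem (mul_mem (hS s hs) (hS t ht)) (inv_mem (hS s hs))) (inv_mem (hS t ht))
  | succ n ih =>
    rintro _ (h | ⟨s, hs, x, hx, rfl⟩)
    · exact ih h
    · exact mul_mem (mul_mem (hS s hs) (ih hx)) (inv_mem (hS s hs))

/-- The sets obtained from `S` by repeatedly passing to conjugated commutators. The depth is
`8 = 2 * 4`, where `4` is the solvability length in `iterCommutator_closure_germ_eq_bot`. -/
def iterConjCommutators (S : Set G) (n : ℕ) : Set G :=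
  (fun T => conjCommutators T 8)^[n] S

theorem iterConjCommutators_subset (hS : S ⊆ H) (n : ℕ) : iterConjCommutators S n ⊆ H := by
  induction n with
  | zero => exact hS
  | succ n ih =>
    rw [iterConjCommutators, Function.iterate_succ_apply']
    exact (conjCommutators_subset_closure _ 8).trans ((Subgroup.closure_le _).2 ih)

theorem closure_conjCommutators_mono (S : Set G) :
    Monotone fun n => Subgroup.closure (conjCommutators S n) :=
  monotone_nat_of_le_succ fun _ => Subgroup.closure_mono Set.subset_union_left

theorem conj_mem_iterCommutator_closure_conjCommutators {s : G} (hs : s ∈ S) (n m : ℕ) {x : G}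
    (hx : x ∈ iterCommutator (Subgroup.closure (conjCommutators S n)) m) :
    s * x * s⁻¹ ∈ iterCommutator (Subgroup.closure (conjCommutators S (n + 1))) m := by
  have hconj : (Subgroup.closure (conjCommutators S n)).map (MulAut.conj s).toMonoidHom ≤
      Subgroup.closure (conjCommutators S (n + 1)) := by
    rw [MonoidHom.map_closure]
    refine Subgroup.closure_mono ?_
    rintro _ ⟨y, hy, rfl⟩
    exact Or.inr ⟨s, hs, y, hy, rfl⟩
  refine iterCommutator_mono hconj m ?_
  rw [← map_iterCommutator]
  exact ⟨x, hx, rfl⟩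

theorem commutator_closure_le (hN : Subgroup.closure S ≤ Subgroup.normalizer N)
    (h : ∀ s ∈ S, ∀ t ∈ S, ⁅s, t⁆ ∈ N) :
    ⁅Subgroup.closure S, Subgroup.closure S⁆ ≤ N := by
  have conj_mem : ∀ g ∈ Subgroup.closure S, ∀ x ∈ N, g * x * g⁻¹ ∈ N := fun g hg x =>
    (Subgroup.mem_normalizer_iff.1 (hN hg) x).1
  have left : ∀ t, (∀ s ∈ S, ⁅s, t⁆ ∈ N) → ∀ g ∈ Subgroup.closure S, ⁅g, t⁆ ∈ N := by
    intro t ht g hg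
    induction hg using Subgroup.closure_induction with
    | mem x hx => exact ht x hx
    | one => rw [commutatorElement_one_left]; exact one_mem N
    | mul x y hx _ ihx ihy =>
      rw [commutatorElement_mul_left_eq_conj_mul]
      exact mul_mem (conj_mem x hx _ ihy) ihx
    | inv x hx ihx =>
      have := conj_mem _ (inv_mem hx) _ (inv_mem ihx)
      rwa [commutatorElement_inv, inv_inv, ← commutatorElement_inv_left] at this
  have swap : ∀ g t, ⁅g, t⁆ ∈ N → ⁅t, g⁆ ∈ N := fun g t hgt => by
    rw [← commutatorElement_inv]
    exact inv_mem hgt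
  exact Subgroup.commutator_le.2 fun g hg t ht =>
    left t (fun s hs => swap t s (left s (fun t ht => h t ht s hs) t ht)) g hg

theorem exists_iterCommutator_not_le_and_le {H : ℕ → Subgroup G} (h0 : ¬ H 0 ≤ N) {d : ℕ}
    (hd : iterCommutator (H (2 * d)) d ≤ N) :
    ∃ i j, ¬ iterCommutator (H i) j ≤ N ∧ iterCommutator (H (i + 2)) (j + 1) ≤ N := by
  by_contra! hcon
  have key : ∀ j, ¬ iterCommutator (H (2 * j)) j ≤ N := fun j => by
    induction j with
    | zero => exact h0
    | succ j ih => exact hcon _ j ih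
  exact key d hd

theorem iterCommutator_one_le_or_exists_monotone
    (hN : Subgroup.closure S ≤ Subgroup.normalizer N) {d : ℕ}
    (hd : iterCommutator (Subgroup.closure (conjCommutators S (2 * d))) d ≤ N) :
    iterCommutator (Subgroup.closure S) 1 ≤ N ∨
      ∃ A : ℕ → Subgroup G, Monotone A ∧ (∀ n, A n ≤ Subgroup.closure S) ∧
        (∀ s ∈ S, ∀ n, ∀ x ∈ A n, s * x * s⁻¹ ∈ A (n + 1)) ∧ ¬ A 0 ≤ N ∧ ⁅A 2, A 2⁆ ≤ N := by
  by_cases h0 : Subgroup.closure (conjCommutators S 0) ≤ N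
  · exact .inl (commutator_closure_le hN fun s hs t ht =>
      h0 (Subgroup.subset_closure ⟨s, hs, t, ht, rfl⟩))
  obtain ⟨i, j, hi, hj⟩ := exists_iterCommutator_not_le_and_le
    (H := fun n => Subgroup.closure (conjCommutators S n)) h0 hd
  refine .inr ⟨fun n => iterCommutator (Subgroup.closure (conjCommutators S (i + n))) j,
    fun m n hmn =>
      iterCommutator_mono (closure_conjCommutators_mono S (Nat.add_le_add_left hmn i)) j,
    fun n => ?_, fun s hs n x => conj_mem_iterCommutator_closure_conjCommutators hs _ j, hi, hj⟩
  exact (iterCommutator_antitone _ j.zero_le).trans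
    ((Subgroup.closure_le _).2 (conjCommutators_subset_closure S _))

end IteratedCommutators

namespace FormalDiffeo

open MvPowerSeries

section OrderFiltration

variable {ι K : Type*}

section CommRing

variable [CommRing K] {i j : ℕ} {u v : MvPowerSeries ι K}

/-- The ideal of power series without terms of degree less than `j`. -/
def ordIdeal (ι K : Type*) [CommRing K] (j : ℕ) : Ideal (MvPowerSeries ι K) where
  carrier := {u | (j : ℕ∞) ≤ u.order}
  add_mem' hu hv := (le_min hu hv).trans min_order_le_add
  zero_mem' := le_top.trans_eq order_zero.symm
  smul_mem' _ _ hu := hu.trans (le_add_self.trans le_order_mul)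

theorem mem_ordIdeal : u ∈ ordIdeal ι K j ↔ (j : ℕ∞) ≤ u.order :=
  Iff.rfl

theorem mem_ordIdeal_iff_coeff : u ∈ ordIdeal ι K j ↔ ∀ d : ι →₀ ℕ, d.degree < j → coeff d u = 0 :=
  ⟨fun hu _ hd => coeff_of_lt_order ((Nat.cast_lt.2 hd).trans_le hu), nat_le_order⟩

theorem mem_ordIdeal_zero (u : MvPowerSeries ι K) : u ∈ ordIdeal ι K 0 :=
  mem_ordIdeal_iff_coeff.2 fun _ hd => absurd hd (Nat.not_lt_zero _)

theorem ordIdeal_antitone : Antitone (ordIdeal ι K) := fun _ _ h _ hu =>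
  mem_ordIdeal.2 ((Nat.cast_le.2 h).trans hu)

theorem mul_mem_ordIdeal (hu : u ∈ ordIdeal ι K i) (hv : v ∈ ordIdeal ι K j) :
    u * v ∈ ordIdeal ι K (i + j) :=
  (Nat.cast_add i j).trans_le ((add_le_add hu hv).trans le_order_mul)

theorem smul_mem_ordIdeal (c : K) (hu : u ∈ ordIdeal ι K j) : c • u ∈ ordIdeal ι K j :=
  hu.trans le_order_smul

theorem eq_zero_of_forall_mem_ordIdeal (h : ∀ j, u ∈ ordIdeal ι K j) : u = 0 := by
  ext d
  exact mem_ordIdeal_iff_coeff.1 (h (d.degree + 1)) d (Nat.lt_succ_self _)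

theorem X_mem_ordIdeal_one (i : ι) : X i ∈ ordIdeal ι K 1 := by
  refine mem_ordIdeal_iff_coeff.2 fun d hd => ?_
  rw [(Finsupp.degree_eq_zero_iff d).1 (Nat.lt_one_iff.1 hd), coeff_zero_X]

theorem sub_truncTotal_mem_ordIdeal [Finite ι] (u : MvPowerSeries ι K) (j : ℕ) :
    u - (truncTotal j u : MvPolynomial ι K) ∈ ordIdeal ι K j :=
  mem_ordIdeal_iff_coeff.2 fun d hd => by
    rw [map_sub, MvPolynomial.coeff_coe, coeff_truncTotal _ hd]
    exact sub_self _

end CommRing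

section Field

variable [Field K] [CharZero K]

theorem exists_eq_C_add_sum_X_mul [Fintype ι] (u : MvPowerSeries ι K) :
    ∃ v : ι → MvPowerSeries ι K, u = C (coeff 0 u) + ∑ i, X i * v i ∧
      ∀ i j, u ∈ ordIdeal ι K (j + 1) → v i ∈ ordIdeal ι K j := by
  classical
  -- Euler's identity `∑ i, d i = |d|` distributes each monomial over the variables.
  let v (i : ι) : MvPowerSeries ι K := fun d =>
    (d i + 1) / (d.degree + 1) * coeff (d + Finsupp.single i 1) u
  have coeff_X_mul_v (i d) : coeff d (X i * v i) = d i / d.degree * coeff d u := by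
    rw [X_def, coeff_monomial_mul, one_mul]
    split_ifs with h
    · obtain ⟨e, rfl⟩ := exists_add_of_le h
      rw [add_tsub_cancel_left, add_comm]
      simp [v, show ∀ f : (ι →₀ ℕ) → K, coeff e f = f e from fun _ => rfl]
    · simp [show d i = 0 by simpa [Finsupp.single_le_iff] using h]
  refine ⟨v, ?_, fun i j hu => mem_ordIdeal_iff_coeff.2 fun d hd => ?_⟩
  · ext d
    simp only [map_add, map_sum, coeff_X_mul_v, ← Finset.sum_mul, ← Finset.sum_div, ← Nat.cast_sum,
      ← Finsupp.degree_eq_sum]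
    rcases eq_or_ne d 0 with rfl | hd
    · simp
    · have : (d.degree : K) ≠ 0 := Nat.cast_ne_zero.2 ((Finsupp.degree_eq_zero_iff d).not.2 hd)
      simp [coeff_C, hd, div_self this]
  · have : coeff (d + Finsupp.single i 1) u = 0 :=
      mem_ordIdeal_iff_coeff.1 hu _ (by simpa using hd)
    change (d i + 1) / (d.degree + 1) * coeff (d + Finsupp.single i 1) u = 0
    rw [this, mul_zero]

variable [Finite ι]

theorem eq_zero_of_map_X_mul {L : MvPowerSeries ι K →+ MvPowerSeries ι K}
    {a : ι → MvPowerSeries ι K} (ha : ∀ i, a i ∈ ordIdeal ι K 1) (hC : ∀ c, L (C c) = 0)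
    (hX : ∀ i u, L (X i * u) = a i * L u) : L = 0 := by
  have := Fintype.ofFinite ι
  have mem : ∀ j u, L u ∈ ordIdeal ι K j := by
    intro j
    induction j with
    | zero => exact fun u => mem_ordIdeal_zero _
    | succ j ih =>
      intro u
      obtain ⟨v, hv, -⟩ := exists_eq_C_add_sum_X_mul u
      rw [hv, map_add, hC, zero_add, map_sum, add_comm j]
      exact Ideal.sum_mem _ fun i _ => hX i (v i) ▸ mul_mem_ordIdeal (ha i) (ih _)
  ext1 u
  exact eq_zero_of_forall_mem_ordIdeal fun j => mem j u

theorem algHom_ext_of_X {σ τ : MvPowerSeries ι K →ₐ[K] MvPowerSeries ι K}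
    (hσ : ∀ i, σ (X i) ∈ ordIdeal ι K 1) (h : ∀ i, σ (X i) = τ (X i)) : σ = τ := by
  refine AlgHom.ext fun u => sub_eq_zero.1 ?_
  refine DFunLike.congr_fun (eq_zero_of_map_X_mul (L := (σ : _ →+ _) - (τ : _ →+ _)) hσ
    (fun c => ?_) fun i u => ?_) u
  · simp [c_eq_algebraMap]
  · simp [← h, mul_sub]

theorem derivation_ext_of_X {D D' : Derivation K (MvPowerSeries ι K) (MvPowerSeries ι K)}
    (h : ∀ i, D (X i) = D' (X i)) : D = D' := by
  refine Derivation.ext fun u => sub_eq_zero.1 ?_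
  refine DFunLike.congr_fun (eq_zero_of_map_X_mul (L := (D : _ →+ _) - (D' : _ →+ _))
    X_mem_ordIdeal_one (fun c => ?_) fun i u => ?_) u
  · simp [c_eq_algebraMap]
  · simp [h, mul_sub]

theorem map_mem_ordIdeal_of_X {σ : MvPowerSeries ι K →ₐ[K] MvPowerSeries ι K}
    (hσ : ∀ i, σ (X i) ∈ ordIdeal ι K 1) (j : ℕ) :
    ∀ u ∈ ordIdeal ι K j, σ u ∈ ordIdeal ι K j := by
  have := Fintype.ofFinite ι
  induction j with
  | zero => exact fun u _ => mem_ordIdeal_zero _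
  | succ j ih =>
    intro u hu
    obtain ⟨v, hv, hv_mem⟩ := exists_eq_C_add_sum_X_mul u
    have hu0 : coeff 0 u = 0 := mem_ordIdeal_iff_coeff.1 hu 0 (by simp)
    rw [hv, hu0, map_zero, zero_add, map_sum, add_comm j]
    exact Ideal.sum_mem _ fun i _ =>
      map_mul σ _ _ ▸ mul_mem_ordIdeal (hσ i) (ih _ (hv_mem i j hu))

theorem sub_mem_ordIdeal_of_X {σ : MvPowerSeries ι K →ₐ[K] MvPowerSeries ι K}
    (hσ : ∀ i, σ (X i) - X i ∈ ordIdeal ι K 2) (j : ℕ) :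
    ∀ u ∈ ordIdeal ι K j, σ u - u ∈ ordIdeal ι K (j + 1) := by
  have := Fintype.ofFinite ι
  have hX : ∀ i, σ (X i) ∈ ordIdeal ι K 1 := fun i => sub_add_cancel (σ (X i)) (X i) ▸
    add_mem (ordIdeal_antitone one_le_two (hσ i)) (X_mem_ordIdeal_one i)
  have sub_eq (u : MvPowerSeries ι K) (v : ι → MvPowerSeries ι K)
      (hv : u = C (coeff 0 u) + ∑ i, X i * v i) :
      σ u - u = ∑ i, ((σ (X i) - X i) * σ (v i) + X i * (σ (v i) - v i)) := by
    rw [hv]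
    simp only [map_add, map_sum, map_mul, c_eq_algebraMap, AlgHom.commutes, add_sub_add_left_eq_sub,
      ← Finset.sum_sub_distrib]
    exact Finset.sum_congr rfl fun i _ => by ring
  induction j with
  | zero =>
    intro u _
    obtain ⟨v, hv, -⟩ := exists_eq_C_add_sum_X_mul u
    rw [sub_eq u v hv]
    exact Ideal.sum_mem _ fun i _ => add_mem
      (Ideal.mul_mem_right _ _ (ordIdeal_antitone one_le_two (hσ i)))
      (Ideal.mul_mem_right _ _ (X_mem_ordIdeal_one i))
  | succ j ih =>
    intro u hu
    obtain ⟨v, hv, hv_mem⟩ := exists_eq_C_add_sum_X_mul u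
    rw [sub_eq u v hv]
    refine Ideal.sum_mem _ fun i _ => add_mem ?_ ?_
    · exact add_comm 2 j ▸
        mul_mem_ordIdeal (hσ i) (map_mem_ordIdeal_of_X hX j _ (hv_mem i j hu))
    · rw [add_comm]
      exact mul_mem_ordIdeal (X_mem_ordIdeal_one i) (ih _ (hv_mem i j hu))

end Field

end OrderFiltration

section Unipotent

/-- The group of automorphisms of the algebra of power series that are tangent to the identity, in
the sense that `σ - 1` raises orders. -/
def unipotent (ι K : Type*) [CommRing K] :
    Subgroup (MvPowerSeries ι K ≃ₐ[K] MvPowerSeries ι K) where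
  carrier := {σ | ∀ j, ∀ u ∈ ordIdeal ι K j, σ u - u ∈ ordIdeal ι K (j + 1)}
  one_mem' j u _ := by simp
  mul_mem' {σ τ} hσ hτ j u hu := by
    have hτu : τ u ∈ ordIdeal ι K j :=
      sub_add_cancel (τ u) u ▸ add_mem (ordIdeal_antitone j.le_succ (hτ j u hu)) hu
    exact sub_add_sub_cancel (σ (τ u)) (τ u) u ▸ add_mem (hσ j _ hτu) (hτ j u hu)
  inv_mem' {σ} hσ j u hu := by
    have hinv : σ (σ⁻¹ u) = u := σ.apply_symm_apply u
    have mem_of_le : ∀ i ≤ j, σ⁻¹ u ∈ ordIdeal ι K i := by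
      intro i
      induction i with
      | zero => exact fun _ => mem_ordIdeal_zero _
      | succ i ih =>
        intro hi
        have h := hσ i _ (ih (Nat.le_of_succ_le hi))
        rw [hinv] at h
        exact sub_sub_cancel u (σ⁻¹ u) ▸ sub_mem (ordIdeal_antitone hi hu) h
    have h := neg_mem (hσ j _ (mem_of_le j le_rfl))
    rwa [hinv, neg_sub] at h

variable {ι K : Type*} [CommRing K] {j : ℕ} {u : MvPowerSeries ι K}

theorem unipotent_smul_sub_mem (σ : unipotent ι K) (hu : u ∈ ordIdeal ι K j) :
    σ • u - u ∈ ordIdeal ι K (j + 1) :=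
  σ.2 j u hu

theorem unipotent_smul_mem (σ : unipotent ι K) (hu : u ∈ ordIdeal ι K j) :
    σ • u ∈ ordIdeal ι K j :=
  sub_add_cancel (σ • u) u ▸
    add_mem (ordIdeal_antitone j.le_succ (unipotent_smul_sub_mem σ hu)) hu

end Unipotent

section DerivationOfFlow

variable {K A : Type*} [CommRing K] [CommRing A] [Algebra K A]

/-- The derivation of `A` given by the first-order part of a ring homomorphism `A → A⟦t⟧` that
reduces to the identity at `t = 0`. -/
def derivationOfFlow (φ : A →+* PowerSeries A) (h0 : ∀ u, PowerSeries.coeff 0 (φ u) = u)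
    (hC : ∀ c : K, φ (algebraMap K A c) = PowerSeries.C (algebraMap K A c)) :
    Derivation K A A :=
  Derivation.mk'
    { toFun := fun u => PowerSeries.coeff 1 (φ u)
      map_add' := fun u v => by rw [map_add, map_add]
      map_smul' := fun c u => by
        rw [Algebra.smul_def, map_mul, hC, PowerSeries.coeff_C_mul, RingHom.id_apply,
          Algebra.smul_def] }
    fun u v => by
      change PowerSeries.coeff 1 (φ (u * v)) =
        u * PowerSeries.coeff 1 (φ v) + v * PowerSeries.coeff 1 (φ u)
      rw [map_mul, PowerSeries.coeff_one_mul, ← PowerSeries.coeff_zero_eq_constantCoeff_apply,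
        ← PowerSeries.coeff_zero_eq_constantCoeff_apply, h0, h0]
      ring

end DerivationOfFlow

section Flow

variable {ι K : Type*} [Field K] {j : ℕ} {u : MvPowerSeries ι K}

/-- The difference operator `σ - 1`. -/
def diffOp (σ : unipotent ι K) : Module.End K (MvPowerSeries ι K) :=
  DistribMulAction.toModuleEnd K _ σ - 1

theorem diffOp_apply (σ : unipotent ι K) (u : MvPowerSeries ι K) : diffOp σ u = σ • u - u :=
  rfl

theorem diffOp_pow_mem (σ : unipotent ι K) (k : ℕ) (hu : u ∈ ordIdeal ι K j) :
    (diffOp σ ^ k) u ∈ ordIdeal ι K (j + k) := by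
  induction k with
  | zero => exact hu
  | succ k ih =>
    rw [pow_succ', Module.End.mul_apply, diffOp_apply]
    exact unipotent_smul_sub_mem σ ih

theorem coeff_diffOp_pow_eq_zero (σ : unipotent ι K) (u : MvPowerSeries ι K) {d : ι →₀ ℕ} {k : ℕ}
    (h : d.degree < k) : coeff d ((diffOp σ ^ k) u) = 0 :=
  mem_ordIdeal_iff_coeff.1 (diffOp_pow_mem σ k (mem_ordIdeal_zero u)) d (by simpa using h)

theorem pow_smul_eq_sum_diffOp (σ : unipotent ι K) (n : ℕ) (u : MvPowerSeries ι K) :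
    σ ^ n • u = ∑ k ∈ Finset.range (n + 1), (n.choose k : K) • (diffOp σ ^ k) u := by
  have h : DistribMulAction.toModuleEnd K (MvPowerSeries ι K) (σ ^ n) = (diffOp σ + 1) ^ n := by
    rw [map_pow, diffOp, sub_add_cancel]
  change DistribMulAction.toModuleEnd K (MvPowerSeries ι K) (σ ^ n) u = _
  rw [h, (Commute.one_right (diffOp σ)).add_pow, LinearMap.sum_apply]
  refine Finset.sum_congr rfl fun k _ => ?_
  rw [one_pow, mul_one, ← nsmul_eq_mul', LinearMap.smul_apply, Nat.cast_smul_eq_nsmul]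

theorem diffOp_pow_conj_smul (τ σ : unipotent ι K) (k : ℕ) (u : MvPowerSeries ι K) :
    (diffOp (τ * σ * τ⁻¹) ^ k) (τ • u) = τ • (diffOp σ ^ k) u := by
  induction k with
  | zero => rfl
  | succ k ih =>
    rw [pow_succ', pow_succ', Module.End.mul_apply, Module.End.mul_apply, ih, diffOp_apply,
      diffOp_apply, smul_sub, smul_smul, inv_mul_cancel_right, mul_smul]

/-- The polynomial whose value at a natural number `n` is `n.choose k`. -/
def binomialPoly (K : Type*) [Field K] (k : ℕ) : Polynomial K :=
  Polynomial.C (k.factorial : K)⁻¹ * descPochhammer K k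

theorem coeff_one_binomialPoly_zero : (binomialPoly K 0).coeff 1 = 0 := by
  simp [binomialPoly, Polynomial.coeff_one]

/-- The series whose coefficients are the polynomials in `n` given by the coefficients of `σⁿ u`,
according to the Newton series of `σⁿ = (1 + (σ - 1))ⁿ`. -/
def iteratePolys (σ : unipotent ι K) (u : MvPowerSeries ι K) : MvPowerSeries ι (Polynomial K) :=
  fun d => ∑ k ∈ Finset.range (d.degree + 1),
    Polynomial.C (coeff d ((diffOp σ ^ k) u)) * binomialPoly K k

theorem coeff_iteratePolys (σ : unipotent ι K) (u : MvPowerSeries ι K) (d : ι →₀ ℕ) :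
    coeff d (iteratePolys σ u) = ∑ k ∈ Finset.range (d.degree + 1),
      Polynomial.C (coeff d ((diffOp σ ^ k) u)) * binomialPoly K k :=
  rfl

/-- Evaluation of polynomial coefficients at a natural number. -/
def evalNat (n : ℕ) : MvPowerSeries ι (Polynomial K) →+* MvPowerSeries ι K :=
  MvPowerSeries.map (Polynomial.evalRingHom (n : K))

theorem coeff_evalNat (n : ℕ) (F : MvPowerSeries ι (Polynomial K)) (d : ι →₀ ℕ) :
    coeff d (evalNat n F) = (coeff d F).eval (n : K) := by
  rw [evalNat, coeff_map, Polynomial.coe_evalRingHom]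

/-- The coefficient of `tᵐ` in a series whose coefficients are polynomials in `t`. -/
def timeCoeff (m : ℕ) (F : MvPowerSeries ι (Polynomial K)) : MvPowerSeries ι K :=
  fun d => (coeff d F).coeff m

theorem coeff_timeCoeff (m : ℕ) (F : MvPowerSeries ι (Polynomial K)) (d : ι →₀ ℕ) :
    coeff d (timeCoeff m F) = (coeff d F).coeff m :=
  rfl

/-- A series with polynomial coefficients, rewritten as a power series in the polynomial
variable. -/
def swapVars : MvPowerSeries ι (Polynomial K) →+* PowerSeries (MvPowerSeries ι K) where
  toFun F := PowerSeries.mk fun m => timeCoeff m F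
  map_one' := by
    classical
    ext m d
    rw [PowerSeries.coeff_mk, PowerSeries.coeff_one, coeff_timeCoeff, coeff_one]
    split_ifs <;> simp_all [Polynomial.coeff_one, coeff_one]
  map_zero' := by
    ext m d
    rw [PowerSeries.coeff_mk, coeff_timeCoeff, map_zero, Polynomial.coeff_zero, map_zero, map_zero]
  map_add' F G := by
    ext m d
    simp only [PowerSeries.coeff_mk, coeff_timeCoeff, map_add, Polynomial.coeff_add]
  map_mul' F G := by
    classical
    ext m d
    simp only [PowerSeries.coeff_mk, PowerSeries.coeff_mul, coeff_timeCoeff, coeff_mul, map_sum,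
      Polynomial.finsetSum_coeff, Polynomial.coeff_mul]
    exact Finset.sum_comm

theorem coeff_coeff_swapVars (m : ℕ) (d : ι →₀ ℕ) (F : MvPowerSeries ι (Polynomial K)) :
    coeff d (PowerSeries.coeff m (swapVars F)) = (coeff d F).coeff m := by
  change coeff d (PowerSeries.coeff m (PowerSeries.mk fun m => timeCoeff m F)) = _
  rw [PowerSeries.coeff_mk, coeff_timeCoeff]

theorem swapVars_injective :
    Function.Injective (swapVars : _ →+* PowerSeries (MvPowerSeries ι K)) := fun F G h => by
  ext d m
  rw [← coeff_coeff_swapVars, ← coeff_coeff_swapVars, h]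

variable [CharZero K]

theorem eval_binomialPoly (n k : ℕ) : (binomialPoly K k).eval (n : K) = n.choose k := by
  rw [binomialPoly, Polynomial.eval_mul, Polynomial.eval_C, Nat.cast_choose_eq_descPochhammer_div,
    div_eq_inv_mul]

theorem polynomial_ext_natCast {p q : Polynomial K} (h : ∀ n : ℕ, p.eval (n : K) = q.eval (n : K)) :
    p = q :=
  Polynomial.eq_of_infinite_eval_eq p q
    ((Set.infinite_range_of_injective Nat.cast_injective).mono (Set.range_subset_iff.2 h))

theorem evalNat_ext {F G : MvPowerSeries ι (Polynomial K)} (h : ∀ n, evalNat n F = evalNat n G) :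
    F = G := by
  ext1 d
  exact polynomial_ext_natCast fun n => by rw [← coeff_evalNat, ← coeff_evalNat, h]

theorem evalNat_iteratePolys (σ : unipotent ι K) (u : MvPowerSeries ι K) (n : ℕ) :
    evalNat n (iteratePolys σ u) = σ ^ n • u := by
  ext d
  have eval_term (k : ℕ) : (Polynomial.C (coeff d ((diffOp σ ^ k) u)) * binomialPoly K k).eval
      (n : K) = n.choose k * coeff d ((diffOp σ ^ k) u) := by
    rw [Polynomial.eval_mul, Polynomial.eval_C, eval_binomialPoly, mul_comm]
  rw [coeff_evalNat, coeff_iteratePolys, Polynomial.eval_finsetSum, pow_smul_eq_sum_diffOp, map_sum]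
  simp_rw [eval_term, coeff_smul]
  refine (Finset.eventually_constant_sum (N := d.degree + 1) (fun k hk => ?_)
    (le_max_left _ (n + 1))).symm.trans
    (Finset.eventually_constant_sum (N := n + 1) (fun k hk => ?_) (le_max_right _ _))
  · rw [coeff_diffOp_pow_eq_zero σ u hk, mul_zero]
  · rw [Nat.choose_eq_zero_of_lt hk, Nat.cast_zero, zero_mul]

/-- The interpolation of the iterates of `σ` is multiplicative because it is so at every natural
number. -/
def interpolation (σ : unipotent ι K) : MvPowerSeries ι K →+* MvPowerSeries ι (Polynomial K) where
  toFun := iteratePolys σ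
  map_one' := evalNat_ext fun n => by rw [evalNat_iteratePolys, map_one, smul_one]
  map_zero' := evalNat_ext fun n => by rw [evalNat_iteratePolys, map_zero, smul_zero]
  map_add' u v := evalNat_ext fun n => by simp only [map_add, evalNat_iteratePolys, smul_add]
  map_mul' u v := evalNat_ext fun n => by simp only [map_mul, evalNat_iteratePolys, smul_mul']

theorem evalNat_interpolation (σ : unipotent ι K) (u : MvPowerSeries ι K) (n : ℕ) :
    evalNat n (interpolation σ u) = σ ^ n • u :=
  evalNat_iteratePolys σ u n

/-- The formal flow of `σ`: the Taylor expansion in `t` of the iterate `σᵗ u`. -/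
def flow (σ : unipotent ι K) : MvPowerSeries ι K →+* PowerSeries (MvPowerSeries ι K) :=
  swapVars.comp (interpolation σ)

theorem flow_apply (σ : unipotent ι K) (u : MvPowerSeries ι K) :
    flow σ u = swapVars (interpolation σ u) :=
  rfl

theorem coeff_zero_flow (σ : unipotent ι K) (u : MvPowerSeries ι K) :
    PowerSeries.coeff 0 (flow σ u) = u := by
  ext d
  have h := coeff_evalNat 0 (interpolation σ u) d
  rw [evalNat_interpolation, pow_zero, one_smul, Nat.cast_zero] at h
  rw [flow_apply, coeff_coeff_swapVars, Polynomial.coeff_zero_eq_eval_zero, h]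

theorem flow_eq_C_of_smul_eq_self {σ : unipotent ι K} (hu : σ • u = u) :
    flow σ u = PowerSeries.C u := by
  have pow_smul (n : ℕ) : σ ^ n • u = u := by
    induction n with
    | zero => rw [pow_zero, one_smul]
    | succ n ih => rw [pow_succ, mul_smul, hu, ih]
  have h : interpolation σ u = MvPowerSeries.map Polynomial.C u := evalNat_ext fun n => by
    ext d
    rw [evalNat_interpolation, pow_smul, coeff_evalNat, coeff_map, Polynomial.eval_C]
  ext m d
  rw [flow_apply, h, coeff_coeff_swapVars, coeff_map, Polynomial.coeff_C, PowerSeries.coeff_C]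
  split_ifs <;> simp

/-- The infinitesimal generator of the formal flow. -/
def logDer (σ : unipotent ι K) : Derivation K (MvPowerSeries ι K) (MvPowerSeries ι K) :=
  derivationOfFlow (flow σ) (coeff_zero_flow σ) fun c =>
    flow_eq_C_of_smul_eq_self (smul_algebraMap σ c)

theorem logDer_apply (σ : unipotent ι K) (u : MvPowerSeries ι K) :
    logDer σ u = PowerSeries.coeff 1 (flow σ u) :=
  rfl

theorem logDer_sub_sum_diffOp_mem (σ : unipotent ι K) (u : MvPowerSeries ι K) (M : ℕ) :
    logDer σ u - ∑ k ∈ Finset.range M, (binomialPoly K k).coeff 1 • (diffOp σ ^ k) u ∈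
      ordIdeal ι K M := by
  refine mem_ordIdeal_iff_coeff.2 fun d hd => ?_
  rw [map_sub, logDer_apply, flow_apply, coeff_coeff_swapVars]
  change Polynomial.coeff (coeff d (iteratePolys σ u)) 1 - _ = 0
  rw [coeff_iteratePolys, Polynomial.finsetSum_coeff, map_sum, sub_eq_zero]
  simp_rw [Polynomial.coeff_C_mul, coeff_smul, mul_comm (coeff d _)]
  exact (Finset.eventually_constant_sum
    (fun k hk => by rw [coeff_diffOp_pow_eq_zero σ u hk, mul_zero]) hd).symm

theorem logDer_mem (σ : unipotent ι K) (hu : u ∈ ordIdeal ι K j) :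
    logDer σ u ∈ ordIdeal ι K (j + 1) := by
  have hsum : ∑ k ∈ Finset.range (j + 1), (binomialPoly K k).coeff 1 • (diffOp σ ^ k) u ∈
      ordIdeal ι K (j + 1) := Ideal.sum_mem _ fun k _ => by
    rcases k with - | k
    · rw [coeff_one_binomialPoly_zero, zero_smul]
      exact zero_mem _
    · exact smul_mem_ordIdeal _ (ordIdeal_antitone (by omega) (diffOp_pow_mem σ (k + 1) hu))
  exact (Submodule.sub_mem_iff_left _ hsum).1 (logDer_sub_sum_diffOp_mem σ u (j + 1))

theorem logDer_conj_smul (τ σ : unipotent ι K) (u : MvPowerSeries ι K) :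
    logDer (τ * σ * τ⁻¹) (τ • u) = τ • logDer σ u := by
  refine sub_eq_zero.1 (eq_zero_of_forall_mem_ordIdeal fun M => ?_)
  have h := sub_mem (logDer_sub_sum_diffOp_mem (τ * σ * τ⁻¹) (τ • u) M)
    (unipotent_smul_mem τ (logDer_sub_sum_diffOp_mem σ u M))
  simp only [diffOp_pow_conj_smul, smul_sub, Finset.smul_sum, smul_comm τ (_ : K)] at h
  rwa [sub_sub_sub_cancel_right] at h

theorem logDer_pow_smul (σ : unipotent ι K) (n : ℕ) (u : MvPowerSeries ι K) :
    logDer σ (σ ^ n • u) = σ ^ n • logDer σ u := by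
  rw [← logDer_conj_smul, (Commute.pow_self σ n).eq, mul_inv_cancel_right]

theorem derivative_coeff_interpolation (σ : unipotent ι K) (u : MvPowerSeries ι K) (d : ι →₀ ℕ) :
    Polynomial.derivative (coeff d (interpolation σ u)) =
      coeff d (interpolation σ (logDer σ u)) := by
  refine polynomial_ext_natCast fun n => ?_
  -- The semigroup law `σⁿ⁺ʲ = σʲ σⁿ` translates the time variable.
  have taylor_eq : Polynomial.taylor (n : K) (coeff d (interpolation σ u)) =
      coeff d (interpolation σ (σ ^ n • u)) := polynomial_ext_natCast fun j => by
    rw [Polynomial.taylor_eval, ← Nat.cast_add, ← coeff_evalNat, ← coeff_evalNat,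
      evalNat_interpolation, evalNat_interpolation, pow_add, mul_smul]
  rw [← Polynomial.taylor_coeff_one, taylor_eq, ← coeff_evalNat, evalNat_interpolation,
    ← logDer_pow_smul, ← coeff_coeff_swapVars, ← flow_apply, logDer_apply]

theorem derivative_flow (σ : unipotent ι K) (u : MvPowerSeries ι K) :
    PowerSeries.derivative _ (flow σ u) = flow σ (logDer σ u) := by
  ext m d
  have hm : (m + 1 : MvPowerSeries ι K) = C (m + 1 : K) := by simp
  rw [PowerSeries.coeff_derivative, hm, coeff_mul_C, flow_apply, flow_apply, coeff_coeff_swapVars,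
    coeff_coeff_swapVars, ← derivative_coeff_interpolation, Polynomial.coeff_derivative]

end Flow

section ConjDer

variable {K A G : Type*} [CommRing K] [CommRing A] [Algebra K A] [Group G] [MulSemiringAction G A]
  [SMulCommClass G K A]

/-- The action of a group of algebra automorphisms on derivations by conjugation. -/
def conjDer : G →* Module.End K (Derivation K A A) where
  toFun g :=
    { toFun := fun D => Derivation.mk'
        { toFun := fun u => g • D (g⁻¹ • u)
          map_add' := fun u v => by rw [smul_add, map_add, smul_add]
          map_smul' := fun c u => by rw [smul_comm, D.map_smul, smul_comm, RingHom.id_apply] }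
        fun u v => by
          change g • D (g⁻¹ • (u * v)) = u • g • D (g⁻¹ • v) + v • g • D (g⁻¹ • u)
          simp only [smul_mul', D.leibniz, smul_add, smul_eq_mul, smul_inv_smul]
      map_add' := fun D E => by ext u; exact smul_add g _ _
      map_smul' := fun c D => by ext u; exact smul_comm g c _ }
  map_one' := by
    ext D u
    change (1 : G) • D ((1 : G)⁻¹ • u) = D u
    rw [inv_one, one_smul, one_smul]
  map_mul' g h := by
    ext D u
    change (g * h) • D ((g * h)⁻¹ • u) = g • h • D (h⁻¹ • g⁻¹ • u)
    rw [mul_inv_rev, mul_smul, mul_smul]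

theorem conjDer_apply (g : G) (D : Derivation K A A) (u : A) :
    conjDer g D u = g • D (g⁻¹ • u) :=
  rfl

theorem conjDer_smul (g : G) (a : A) (D : Derivation K A A) :
    conjDer g (a • D) = (g • a) • conjDer g D := by
  ext u
  exact smul_mul' g a _

end ConjDer

section FractionField

/-- The field of fractions of the ring of formal power series. -/
abbrev FracSeries (ι K : Type*) [Field K] : Type _ := FractionRing (MvPowerSeries ι K)

variable {ι K : Type*} [Field K]

instance : MulSemiringAction (unipotent ι K) (FracSeries ι K) :=
  IsFractionRing.mulSemiringAction _ (MvPowerSeries ι K) _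

theorem smul_algebraMap_frac (σ : unipotent ι K) (a : MvPowerSeries ι K) :
    σ • algebraMap _ (FracSeries ι K) a = algebraMap _ _ (σ • a) :=
  (algebraMap.coe_smul' σ a (FracSeries ι K)).symm

instance : FaithfulSMul (unipotent ι K) (FracSeries ι K) :=
  IsFractionRing.faithfulSMul _ (MvPowerSeries ι K) _

instance : SMulCommClass (unipotent ι K) K (FracSeries ι K) :=
  IsFractionRing.smulCommClass _ K (MvPowerSeries ι K) K _

theorem algebraMap_frac_ne_zero {b : MvPowerSeries ι K} (hb : b ≠ 0) :
    algebraMap _ (FracSeries ι K) b ≠ 0 :=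
  (FaithfulSMul.algebraMap_eq_zero_iff _ _).not.2 hb

theorem exists_mul_algebraMap_eq (u : FracSeries ι K) :
    ∃ a b : MvPowerSeries ι K, b ≠ 0 ∧ u * algebraMap _ _ b = algebraMap _ _ a := by
  obtain ⟨⟨a, b⟩, h⟩ := IsLocalization.surj (nonZeroDivisors (MvPowerSeries ι K)) u
  exact ⟨a, b, nonZeroDivisors.coe_ne_zero b, h⟩

theorem derivation_ext_of_algebraMap {D E : Derivation K (FracSeries ι K) (FracSeries ι K)}
    (h : ∀ a : MvPowerSeries ι K, D (algebraMap _ _ a) = E (algebraMap _ _ a)) : D = E := by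
  ext u
  obtain ⟨a, b, hb, hu⟩ := exists_mul_algebraMap_eq u
  have ha := h a
  rw [← hu, D.leibniz, E.leibniz, h b, smul_eq_mul, smul_eq_mul, smul_eq_mul] at ha
  exact mul_left_cancel₀ (algebraMap_frac_ne_zero hb) (add_left_cancel ha)

theorem ringHom_eq_iff_of_mul_eq {R : Type*} [CommRing R] [IsDomain R] (φ ψ : FracSeries ι K →+* R)
    {u w b d : FracSeries ι K} (hb : b ≠ 0) (hd : d ≠ 0) :
    φ u = ψ w ↔ φ (u * b) * ψ d = ψ (w * d) * φ b := by
  have hbd : φ b * ψ d ≠ 0 := mul_ne_zero ((map_ne_zero_iff φ φ.injective).2 hb)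
    ((map_ne_zero_iff ψ ψ.injective).2 hd)
  rw [map_mul, map_mul, mul_assoc, mul_assoc, mul_comm (ψ d), mul_left_inj' hbd]

variable [CharZero K]

instance : CharZero (FracSeries ι K) :=
  charZero_of_injective_algebraMap (algebraMap K (FracSeries ι K)).injective

theorem isUnit_map_flow (σ : unipotent ι K) (b : nonZeroDivisors (MvPowerSeries ι K)) :
    IsUnit (((PowerSeries.map (algebraMap _ (FracSeries ι K))).comp (flow σ)) b) := by
  rw [PowerSeries.isUnit_iff_constantCoeff, ← PowerSeries.coeff_zero_eq_constantCoeff_apply,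
    RingHom.comp_apply, PowerSeries.coeff_map, coeff_zero_flow, isUnit_iff_ne_zero]
  exact algebraMap_frac_ne_zero (nonZeroDivisors.coe_ne_zero b)

/-- The formal flow of `σ` on the field of fractions. -/
def fracFlow (σ : unipotent ι K) : FracSeries ι K →+* PowerSeries (FracSeries ι K) :=
  IsLocalization.lift (isUnit_map_flow σ)

theorem fracFlow_algebraMap (σ : unipotent ι K) (a : MvPowerSeries ι K) :
    fracFlow σ (algebraMap _ _ a) = PowerSeries.map (algebraMap _ _) (flow σ a) :=
  IsLocalization.lift_eq _ _

theorem coeff_zero_fracFlow (σ : unipotent ι K) (u : FracSeries ι K) :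
    PowerSeries.coeff 0 (fracFlow σ u) = u := by
  have h : PowerSeries.constantCoeff.comp (fracFlow σ) = RingHom.id _ :=
    IsLocalization.ringHom_ext (nonZeroDivisors (MvPowerSeries ι K)) <| RingHom.ext fun a => by
      rw [RingHom.comp_apply, RingHom.comp_apply, fracFlow_algebraMap,
        ← PowerSeries.coeff_zero_eq_constantCoeff_apply, PowerSeries.coeff_map, coeff_zero_flow]
      rfl
  rw [PowerSeries.coeff_zero_eq_constantCoeff_apply]
  exact RingHom.congr_fun h u

theorem fracFlow_algebraMap_base (σ : unipotent ι K) (c : K) :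
    fracFlow σ (algebraMap K _ c) = PowerSeries.C (algebraMap K _ c) := by
  rw [IsScalarTower.algebraMap_apply K (MvPowerSeries ι K), fracFlow_algebraMap,
    flow_eq_C_of_smul_eq_self (smul_algebraMap σ c), PowerSeries.map_C]

theorem fracFlow_eq_iff (σ τ : unipotent ι K) (u w : FracSeries ι K) :
    fracFlow σ u = fracFlow τ w ↔ ∀ n : ℕ, σ ^ n • u = τ ^ n • w := by
  obtain ⟨a, b, hb, hu⟩ := exists_mul_algebraMap_eq u
  obtain ⟨c, d, hd, hw⟩ := exists_mul_algebraMap_eq w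
  have hb' := algebraMap_frac_ne_zero hb
  have hd' := algebraMap_frac_ne_zero hd
  -- Clearing denominators reduces both sides to an identity of series with polynomial coefficients.
  have flow_iff : fracFlow σ u = fracFlow τ w ↔
      interpolation σ a * interpolation τ d = interpolation τ c * interpolation σ b := by
    rw [ringHom_eq_iff_of_mul_eq _ _ hb' hd', hu, hw]
    simp only [fracFlow_algebraMap, ← map_mul, flow_apply]
    rw [(PowerSeries.map_injective _ (FaithfulSMul.algebraMap_injective _ _)).eq_iff,
      swapVars_injective.eq_iff]
  have smul_iff (n : ℕ) : σ ^ n • u = τ ^ n • w ↔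
      evalNat n (interpolation σ a * interpolation τ d) =
        evalNat n (interpolation τ c * interpolation σ b) := by
    have h := ringHom_eq_iff_of_mul_eq (MulSemiringAction.toRingHom _ _ (σ ^ n))
      (MulSemiringAction.toRingHom _ _ (τ ^ n)) (u := u) (w := w) hb' hd'
    simp only [hu, hw, MulSemiringAction.toRingHom_apply, smul_algebraMap_frac, ← map_mul,
      (FaithfulSMul.algebraMap_injective _ _).eq_iff] at h
    simp only [h, map_mul, evalNat_interpolation]
  rw [flow_iff]
  simp only [smul_iff]
  exact ⟨fun h n => by rw [h], evalNat_ext⟩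

/-- The infinitesimal generator of the formal flow on the field of fractions. -/
def fracLog (σ : unipotent ι K) : Derivation K (FracSeries ι K) (FracSeries ι K) :=
  derivationOfFlow (fracFlow σ) (coeff_zero_fracFlow σ) (fracFlow_algebraMap_base σ)

theorem fracLog_apply (σ : unipotent ι K) (u : FracSeries ι K) :
    fracLog σ u = PowerSeries.coeff 1 (fracFlow σ u) :=
  rfl

theorem fracLog_algebraMap (σ : unipotent ι K) (a : MvPowerSeries ι K) :
    fracLog σ (algebraMap _ _ a) = algebraMap _ _ (logDer σ a) := by
  rw [fracLog_apply, fracFlow_algebraMap, PowerSeries.coeff_map, logDer_apply]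

theorem fracLog_conj (τ σ : unipotent ι K) : fracLog (τ * σ * τ⁻¹) = conjDer τ (fracLog σ) :=
  derivation_ext_of_algebraMap fun a => by
    rw [conjDer_apply, smul_algebraMap_frac, fracLog_algebraMap, fracLog_algebraMap,
      smul_algebraMap_frac, ← logDer_conj_smul, smul_inv_smul]

theorem derivative_fracFlow (σ : unipotent ι K) (u : FracSeries ι K) :
    PowerSeries.derivative _ (fracFlow σ u) = fracFlow σ (fracLog σ u) := by
  have algebraMap_case (c : MvPowerSeries ι K) :
      PowerSeries.derivative _ (fracFlow σ (algebraMap _ _ c)) =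
        fracFlow σ (fracLog σ (algebraMap _ _ c)) := by
    rw [fracLog_algebraMap, fracFlow_algebraMap, fracFlow_algebraMap, ← derivative_flow]
    ext1 m
    simp only [PowerSeries.coeff_derivative, PowerSeries.coeff_map, map_mul, map_add, map_natCast,
      map_one]
  obtain ⟨a, b, hb, hu⟩ := exists_mul_algebraMap_eq u
  have ha := algebraMap_case a
  rw [← hu, map_mul, Derivation.leibniz, Derivation.leibniz, map_add, algebraMap_case b,
    smul_eq_mul, smul_eq_mul, smul_eq_mul, smul_eq_mul, map_mul, map_mul] at ha
  exact mul_left_cancel₀ ((map_ne_zero_iff _ (fracFlow σ).injective).2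
    (algebraMap_frac_ne_zero hb)) (add_left_cancel ha)

theorem coeff_succ_fracFlow (σ : unipotent ι K) (u : FracSeries ι K) (m : ℕ) :
    PowerSeries.coeff (m + 1) (fracFlow σ u) * (m + 1) =
      PowerSeries.coeff m (fracFlow σ (fracLog σ u)) := by
  rw [← derivative_fracFlow, PowerSeries.coeff_derivative]

section Agreement

variable {k : Set (FracSeries ι K)} {σ τ : unipotent ι K} {u : FracSeries ι K}

theorem coeff_fracFlow_eq_of_fracLog_eqOn (hk : ∀ u ∈ k, fracLog σ u ∈ k)
    (h : Set.EqOn (fracLog σ) (fracLog τ) k) (m : ℕ) (hu : u ∈ k) :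
    PowerSeries.coeff m (fracFlow σ u) = PowerSeries.coeff m (fracFlow τ u) := by
  induction m generalizing u with
  | zero => rw [coeff_zero_fracFlow, coeff_zero_fracFlow]
  | succ m ih =>
    refine mul_right_cancel₀ (Nat.cast_add_one_ne_zero m : (m + 1 : FracSeries ι K) ≠ 0) ?_
    rw [coeff_succ_fracFlow, coeff_succ_fracFlow, ← h hu, ih (hk u hu)]

theorem smul_eqOn_of_fracLog_eqOn (hk : ∀ u ∈ k, fracLog σ u ∈ k)
    (h : Set.EqOn (fracLog σ) (fracLog τ) k) : Set.EqOn (σ • ·) (τ • ·) k := fun u hu => by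
  simpa only [pow_one] using (fracFlow_eq_iff σ τ u u).1
    (PowerSeries.ext fun m => coeff_fracFlow_eq_of_fracLog_eqOn hk h m hu) 1

theorem fracLog_eqOn_of_smul_eqOn (hk : ∀ u ∈ k, σ • u ∈ k)
    (h : Set.EqOn (σ • ·) (τ • ·) k) : Set.EqOn (fracLog σ) (fracLog τ) k := fun u hu => by
  have pow_eq (n : ℕ) : ∀ v ∈ k, σ ^ n • v = τ ^ n • v := by
    induction n with
    | zero => exact fun v _ => rfl
    | succ n ih =>
      intro v hv
      have h_one : σ • v = τ • v := h hv
      rw [pow_succ, pow_succ, mul_smul, mul_smul, ← h_one, ih _ (hk v hv)]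
  rw [fracLog_apply, fracLog_apply, (fracFlow_eq_iff σ τ u u).2 fun n => pow_eq n u hu]

theorem fracLog_injective :
    Function.Injective (fracLog : unipotent ι K → Derivation K (FracSeries ι K) _) :=
  fun σ τ h => eq_of_smul_eq_smul (α := FracSeries ι K) fun u =>
    smul_eqOn_of_fracLog_eqOn (k := Set.univ) (fun _ _ => trivial) (fun v _ => by rw [h]) trivial

theorem conjDer_fracLog_eq_self_iff :
    conjDer τ (fracLog σ) = fracLog σ ↔ Commute τ σ := by
  rw [← fracLog_conj, fracLog_injective.eq_iff, mul_inv_eq_iff_eq_mul]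
  rfl

theorem fracLog_one : fracLog (1 : unipotent ι K) = 0 :=
  derivation_ext_of_algebraMap fun a => by
    rw [fracLog_algebraMap, logDer_apply, flow_eq_C_of_smul_eq_self (one_smul _ a),
      PowerSeries.coeff_C, if_neg one_ne_zero, map_zero, Derivation.zero_apply]

theorem smul_eq_self_iff_fracLog_eq_zero : σ • u = u ↔ fracLog σ u = 0 := by
  constructor
  · intro h
    have hlog := fracLog_eqOn_of_smul_eqOn (k := {u}) (σ := σ) (τ := 1)
      (by rintro _ rfl; exact h) (by rintro _ rfl; simp only [h, one_smul]) rfl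
    rwa [fracLog_one] at hlog
  · intro h
    have hsmul := smul_eqOn_of_fracLog_eqOn (k := {u, 0}) (σ := σ) (τ := 1)
      (by rintro v (rfl | rfl) <;> simp [h])
      (by rintro v (rfl | rfl) <;> simp [h, fracLog_one]) (Set.mem_insert u _)
    simpa only [one_smul] using hsmul

theorem fracLog_mem_fixedBy {γ δ : unipotent ι K}
    (h : ∀ u ∈ MulAction.fixedBy (FracSeries ι K) γ, δ • u ∈ MulAction.fixedBy _ γ)
    (hu : u ∈ MulAction.fixedBy (FracSeries ι K) γ) : fracLog δ u ∈ MulAction.fixedBy _ γ := by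
  have pow_mem (n : ℕ) : δ ^ n • u ∈ MulAction.fixedBy (FracSeries ι K) γ := by
    induction n with
    | zero => rwa [pow_zero, one_smul]
    | succ n ih => rw [pow_succ', mul_smul]; exact h _ ih
  have inv_smul : γ⁻¹ • u = u := inv_smul_eq_iff.2 (MulAction.mem_fixedBy.1 hu).symm
  have flow_eq : fracFlow (γ * δ * γ⁻¹) u = fracFlow δ u := (fracFlow_eq_iff _ _ _ _).2 fun n => by
    rw [conj_pow, mul_smul, mul_smul, inv_smul]
    exact pow_mem n
  have conj_eq := DFunLike.congr_fun (fracLog_conj γ δ) u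
  rw [conjDer_apply, inv_smul, fracLog_apply, flow_eq, ← fracLog_apply] at conj_eq
  exact conj_eq.symm

end Agreement

end FractionField

section Frame

open scoped TensorProduct

variable {ι K : Type*} [Field K]

/-- The partial derivatives on the field of fractions. -/
def fracPDeriv (i : ι) : Derivation K (FracSeries ι K) (FracSeries ι K) :=
  have : Algebra.FormallyEtale (MvPowerSeries ι K) (FracSeries ι K) :=
    .of_isLocalization (nonZeroDivisors (MvPowerSeries ι K))
  let D := (Algebra.linearMap (MvPowerSeries ι K) (FracSeries ι K)).compDer (pderiv K i)
  KaehlerDifferential.linearMapEquivDerivation K (FracSeries ι K)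
    (D.liftKaehlerDifferential.liftBaseChange (FracSeries ι K) ∘ₗ
      (KaehlerDifferential.tensorKaehlerEquivOfFormallyEtale K (MvPowerSeries ι K)
        (FracSeries ι K)).symm.toLinearMap)

theorem fracPDeriv_algebraMap (i : ι) (a : MvPowerSeries ι K) :
    fracPDeriv i (algebraMap _ (FracSeries ι K) a) = algebraMap _ _ (pderiv K i a) := by
  have : Algebra.FormallyEtale (MvPowerSeries ι K) (FracSeries ι K) :=
    .of_isLocalization (nonZeroDivisors (MvPowerSeries ι K))
  change LinearMap.liftBaseChange _ _ ((KaehlerDifferential.tensorKaehlerEquivOfFormallyEtale K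
    (MvPowerSeries ι K) (FracSeries ι K)).symm (KaehlerDifferential.D K _ (algebraMap _ _ a))) = _
  rw [KaehlerDifferential.tensorKaehlerEquivOfFormallyEtale_symm_D_algebraMap,
    LinearMap.liftBaseChange_tmul, one_smul, Derivation.liftKaehlerDifferential_comp_D]
  rfl

theorem derivation_sum_apply {A M κ : Type*} [CommRing A] [Algebra K A] [AddCommGroup M]
    [Module A M] [Module K M] (s : Finset κ) (D : κ → Derivation K A M) (a : A) :
    (∑ i ∈ s, D i) a = ∑ i ∈ s, D i a := by
  rw [← Derivation.coeFnAddMonoidHom_apply, map_sum, Finset.sum_apply]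
  rfl

variable [CharZero K]

theorem eq_C_of_pderiv_eq_zero {a : MvPowerSeries ι K} (h : ∀ i, pderiv K i a = 0) :
    a = C (constantCoeff a) := by
  classical
  ext d
  rw [coeff_C]
  split_ifs with hd
  · rw [hd, coeff_zero_eq_constantCoeff_apply]
  · obtain ⟨i, hi⟩ := Finsupp.ne_iff.1 hd
    have hle : Finsupp.single i 1 ≤ d := Finsupp.single_le_iff.2 (Nat.one_le_iff_ne_zero.2 hi)
    have hcoeff := congrArg (coeff (d - Finsupp.single i 1)) (h i)
    rw [coeff_pderiv, tsub_add_cancel_of_le hle, map_zero] at hcoeff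
    exact (mul_eq_zero.1 hcoeff).resolve_right (Nat.cast_add_one_ne_zero _)

/-- Differentiating numerator and denominator turns the denominator into a unit. -/
theorem mem_range_algebraMap_of_fracPDeriv_eq_zero {u : FracSeries ι K}
    (hu : ∀ i, fracPDeriv i u = 0) (d : ι →₀ ℕ) {a b : MvPowerSeries ι K} (hb : coeff d b ≠ 0)
    (hab : u * algebraMap _ _ b = algebraMap _ _ a) :
    u ∈ Set.range (algebraMap (MvPowerSeries ι K) (FracSeries ι K)) := by
  induction hn : d.degree generalizing d a b with
  | zero =>
    rw [Finsupp.degree_eq_zero_iff] at hn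
    rw [hn, coeff_zero_eq_constantCoeff_apply] at hb
    obtain ⟨c, hc⟩ :=
      (MvPowerSeries.isUnit_iff_constantCoeff.2 (isUnit_iff_ne_zero.2 hb)).exists_right_inv
    refine ⟨a * c, ?_⟩
    rw [map_mul, ← hab, mul_assoc, ← map_mul, hc, map_one, mul_one]
  | succ n ih =>
    obtain ⟨i, hi⟩ : ∃ i, d i ≠ 0 := by
      by_contra! h
      have hd : d = 0 := Finsupp.ext h
      rw [hd, map_zero] at hn
      omega
    have hle : Finsupp.single i 1 ≤ d := Finsupp.single_le_iff.2 (Nat.one_le_iff_ne_zero.2 hi)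
    have hsub := tsub_add_cancel_of_le hle
    refine ih (d - Finsupp.single i 1) (a := pderiv K i a) (b := pderiv K i b) ?_ ?_ ?_
    · rw [coeff_pderiv, hsub]
      exact mul_ne_zero hb (Nat.cast_add_one_ne_zero _)
    · have h := congrArg (fracPDeriv i) hab
      rwa [Derivation.leibniz, hu i, smul_zero, add_zero, fracPDeriv_algebraMap,
        fracPDeriv_algebraMap, smul_eq_mul] at h
    · have h := congrArg Finsupp.degree hsub
      rw [map_add, Finsupp.degree_single, hn] at h
      omega

theorem mem_range_algebraMap_base_of_fracPDeriv_eq_zero {u : FracSeries ι K}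
    (hu : ∀ i, fracPDeriv i u = 0) : u ∈ Set.range (algebraMap K (FracSeries ι K)) := by
  obtain ⟨a, b, hb, hab⟩ := exists_mul_algebraMap_eq u
  obtain ⟨d, hd⟩ := (ne_zero_iff_exists_coeff_ne_zero b).1 hb
  obtain ⟨v, rfl⟩ := mem_range_algebraMap_of_fracPDeriv_eq_zero hu d hd hab
  have hv : v = C (constantCoeff v) := eq_C_of_pderiv_eq_zero fun i =>
    FaithfulSMul.algebraMap_injective _ (FracSeries ι K) <| by
      rw [← fracPDeriv_algebraMap, hu, map_zero]
  exact ⟨constantCoeff v, by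
    rw [IsScalarTower.algebraMap_apply K (MvPowerSeries ι K), ← c_eq_algebraMap, ← hv]⟩

theorem fracLog_eq_sum [Fintype ι] (σ : unipotent ι K) :
    fracLog σ = ∑ i, algebraMap _ (FracSeries ι K) (logDer σ (X i)) • fracPDeriv i := by
  classical
  have coordinates : logDer σ = ∑ i, logDer σ (X i) • pderiv K i := derivation_ext_of_X fun j => by
    rw [derivation_sum_apply, Finset.sum_eq_single j]
    · rw [Derivation.smul_apply, pderiv_X_self, smul_eq_mul, mul_one]
    · intro i _ hij
      rw [Derivation.smul_apply, pderiv_X_of_ne hij.symm, smul_zero]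
    · exact fun h => (h (Finset.mem_univ j)).elim
  refine derivation_ext_of_algebraMap fun a => ?_
  conv_lhs => rw [fracLog_algebraMap, coordinates]
  simp only [derivation_sum_apply, Derivation.smul_apply, map_sum, smul_eq_mul, map_mul,
    fracPDeriv_algebraMap]

theorem fracLog_mem_span_fracPDeriv [Finite ι] (σ : unipotent ι K) :
    fracLog σ ∈ Submodule.span (FracSeries ι K) (Set.range fracPDeriv) := by
  have := Fintype.ofFinite ι
  rw [fracLog_eq_sum]
  exact sum_mem fun i _ => Submodule.smul_mem _ _ (Submodule.subset_span ⟨i, rfl⟩)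

variable {p : ι → unipotent ι K}

theorem span_fracLog_eq [Finite ι] (hp : LinearIndependent (FracSeries ι K) (fracLog ∘ p)) :
    Submodule.span (FracSeries ι K) (Set.range (fracLog ∘ p)) =
      Submodule.span (FracSeries ι K) (Set.range fracPDeriv) := by
  have := Fintype.ofFinite ι
  have : FiniteDimensional (FracSeries ι K)
      (Submodule.span (FracSeries ι K) (Set.range (fracPDeriv (ι := ι) (K := K)))) :=
    .span_of_finite _ (Set.finite_range _)
  refine Submodule.eq_of_le_of_finrank_le (Submodule.span_le.2 ?_) ?_
  · rintro _ ⟨i, rfl⟩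
    exact fracLog_mem_span_fracPDeriv (p i)
  · rw [finrank_span_eq_card hp]
    exact finrank_range_le_card _

theorem exists_fracLog_eq_sum [Fintype ι]
    (hp : LinearIndependent (FracSeries ι K) (fracLog ∘ p)) (η : unipotent ι K) :
    ∃ c : ι → FracSeries ι K, fracLog η = ∑ i, c i • fracLog (p i) := by
  have h := fracLog_mem_span_fracPDeriv η
  rw [← span_fracLog_eq hp, Submodule.mem_span_range_iff_exists_fun] at h
  obtain ⟨c, hc⟩ := h
  exact ⟨c, hc.symm⟩

theorem mem_range_algebraMap_base_of_forall_smul_eq [Finite ι]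
    (hp : LinearIndependent (FracSeries ι K) (fracLog ∘ p)) {u : FracSeries ι K}
    (hu : ∀ i, p i • u = u) : u ∈ Set.range (algebraMap K (FracSeries ι K)) := by
  have killed : ∀ D ∈ Submodule.span (FracSeries ι K) (Set.range (fracLog ∘ p)), D u = 0 := by
    intro D hD
    induction hD using Submodule.span_induction with
    | mem D hD =>
      obtain ⟨i, rfl⟩ := hD
      exact smul_eq_self_iff_fracLog_eq_zero.1 (hu i)
    | zero => rfl
    | add D E _ _ hD hE => rw [Derivation.add_apply, hD, hE, add_zero]
    | smul a D _ hD => rw [Derivation.smul_apply, hD, smul_zero]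
  rw [span_fracLog_eq hp] at killed
  exact mem_range_algebraMap_base_of_fracPDeriv_eq_zero fun i =>
    killed _ (Submodule.subset_span ⟨i, rfl⟩)

theorem smul_eq_of_commute [Fintype ι]
    (hp : LinearIndependent (FracSeries ι K) (fracLog ∘ p))
    {η δ : unipotent ι K} {c : ι → FracSeries ι K} (hη : fracLog η = ∑ i, c i • fracLog (p i))
    (hδη : Commute δ η) (hδ : ∀ i, Commute δ (p i)) (i : ι) : δ • c i = c i := by
  have h := congrArg (conjDer δ) hη
  simp only [map_sum, conjDer_smul, conjDer_fracLog_eq_self_iff.2 hδη,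
    conjDer_fracLog_eq_self_iff.2 (hδ _)] at h
  exact (LinearIndependent.eq_coords_of_eq hp (f := c) (g := fun i => δ • c i)
    (hη.symm.trans h) i).symm

theorem exists_logDer_eq_sum_of_commute [Fintype ι]
    (hp : LinearIndependent (FracSeries ι K) (fracLog ∘ p))
    (hcomm : ∀ i j, Commute (p i) (p j)) {η : unipotent ι K} (hη : ∀ i, Commute (p i) η) :
    ∃ c : ι → K, logDer η = ∑ i, c i • logDer (p i) := by
  obtain ⟨c, hc⟩ := exists_fracLog_eq_sum hp η
  choose d hd using fun i => mem_range_algebraMap_base_of_forall_smul_eq hp fun j =>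
    smul_eq_of_commute hp hc (hη j) (hcomm j) i
  refine ⟨d, Derivation.ext fun a => FaithfulSMul.algebraMap_injective _ (FracSeries ι K) ?_⟩
  rw [← fracLog_algebraMap, hc]
  simp only [← hd, derivation_sum_apply, Derivation.smul_apply, map_sum, fracLog_algebraMap,
    algebraMap_smul, Algebra.smul_def, map_mul, ← IsScalarTower.algebraMap_apply]

end Frame

section Raising

open scoped commutatorElement

variable {G K V : Type*} [Group G] [Field K] [AddCommGroup V] [Module K V]
  {F : ℕ → Submodule K V} {W : Submodule K V} {T T' : Module.End K V}

theorem apply_eq_zero_of_apply_eq_smul (hsep : ⨅ n, F n = ⊥)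
    (hT : ∀ n, ∀ v ∈ F n, T v ∈ F (n + 1)) {v : V} (hv : v ∈ F 0) {c : K} (h : T v = c • v) :
    T v = 0 := by
  rcases eq_or_ne c 0 with rfl | hc
  · rw [h, zero_smul]
  have mem : ∀ n, v ∈ F n := by
    intro n
    induction n with
    | zero => exact hv
    | succ n ih => exact ((F (n + 1)).smul_mem_iff hc).1 (h ▸ hT n v ih)
  have hv0 : v ∈ ⨅ n, F n := (Submodule.mem_iInf F).2 mem
  rw [hsep, Submodule.mem_bot] at hv0
  rw [hv0, map_zero]

theorem apply_eq_zero_of_finrank_le_one [FiniteDimensional K W] (hW : Module.finrank K W ≤ 1)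
    (hsep : ⨅ n, F n = ⊥) (hW0 : W ≤ F 0) (hT : ∀ n, ∀ v ∈ F n, T v ∈ F (n + 1))
    (hTW : ∀ v ∈ W, T v ∈ W) : ∀ v ∈ W, T v = 0 := by
  obtain ⟨v₀, hv₀⟩ := finrank_le_one_iff.1 hW
  intro v hv
  obtain ⟨a, ha⟩ := hv₀ ⟨v, hv⟩
  obtain ⟨c, hc⟩ := hv₀ ⟨T v₀, hTW _ v₀.2⟩
  have hT₀ : T v₀ = 0 :=
    apply_eq_zero_of_apply_eq_smul hsep hT (hW0 v₀.2) (congrArg Subtype.val hc).symm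
  rw [← show a • (v₀ : V) = v from congrArg Subtype.val ha, map_smul, hT₀, smul_zero]

theorem apply_apply_eq_zero_of_finrank_le_two [FiniteDimensional K W]
    (hW : Module.finrank K W ≤ 2) (hF : Antitone F) (hsep : ⨅ n, F n = ⊥) (hW0 : W ≤ F 0)
    (hT : ∀ n, ∀ v ∈ F n, T v ∈ F (n + 1)) (hT' : ∀ n, ∀ v ∈ F n, T' v ∈ F (n + 1))
    (hTW : ∀ v ∈ W, T v ∈ W) (hTW' : ∀ v ∈ W, T' v ∈ W) : ∀ v ∈ W, T (T' v) = 0 := by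
  by_cases hall : ∀ n, W ≤ F n
  · intro v hv
    have hTv := le_iInf hall (hTW' v hv)
    rw [hsep, Submodule.mem_bot] at hTv
    rw [hTv, map_zero]
  obtain ⟨r, hr, hr'⟩ : ∃ r, W ≤ F r ∧ ¬ W ≤ F (r + 1) := by
    by_contra! hcon
    exact hall fun n => Nat.rec hW0 hcon n
  have hlt : W ⊓ F (r + 1) < W := inf_lt_left.2 hr'
  have : FiniteDimensional K ↥(W ⊓ F (r + 1)) := Submodule.finiteDimensional_of_le inf_le_left
  have hfinrank : Module.finrank K ↥(W ⊓ F (r + 1)) ≤ 1 :=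
    Nat.le_of_lt_succ ((Submodule.finrank_lt_finrank_of_lt hlt).trans_le hW)
  intro v hv
  refine apply_eq_zero_of_finrank_le_one hfinrank hsep (inf_le_left.trans hW0) hT ?_ _
    ⟨hTW' v hv, hT' r v (hr hv)⟩
  exact fun w hw => ⟨hTW w hw.1, hF (Nat.le_succ _) (hT _ w hw.2)⟩

variable {ρ : G →* Module.End K V}

theorem map_eq_of_mem_closure [FiniteDimensional K W] {S : Set G}
    (h : ∀ s ∈ S, ∀ v ∈ W, ρ s v ∈ W) :
    ∀ g ∈ Subgroup.closure S, W.map (ρ g) = W := by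
  intro g hg
  induction hg using Subgroup.closure_induction with
  | mem s hs =>
    have inj : Function.Injective (ρ s) := Function.LeftInverse.injective (g := ρ s⁻¹) fun v => by
      rw [← Module.End.mul_apply, ← map_mul, inv_mul_cancel, map_one, Module.End.one_apply]
    exact Submodule.eq_of_le_of_finrank_eq (Submodule.map_le_iff_le_comap.2 (h s hs))
      (Submodule.equivMapOfInjective _ inj W).finrank_eq.symm
  | one => rw [map_one]; exact Submodule.map_id W
  | mul g g' _ _ hg hg' => rw [map_mul, Module.End.mul_eq_comp, Submodule.map_comp, hg', hg]
  | inv g _ hg =>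
    conv_lhs => rw [← hg]
    rw [← Submodule.map_comp, ← Module.End.mul_eq_comp, ← map_mul, inv_mul_cancel, map_one]
    exact Submodule.map_id W

theorem apply_eq_self_of_mem_commutator [FiniteDimensional K W] (hW : Module.finrank K W ≤ 2)
    (hF : Antitone F) (hsep : ⨅ n, F n = ⊥) (hW0 : W ≤ F 0)
    (hρ : ∀ g n, ∀ v ∈ F n, ρ g v - v ∈ F (n + 1)) {H : Subgroup G}
    (hHW : ∀ g ∈ H, W.map (ρ g) = W) : ∀ g ∈ ⁅H, H⁆, ∀ v ∈ W, ρ g v = v := by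
  have mem : ∀ g ∈ H, ∀ v ∈ W, ρ g v ∈ W := fun g hg v hv =>
    hHW g hg ▸ Submodule.mem_map_of_mem hv
  have expand : ∀ x ∈ H, ∀ y ∈ H, ∀ v ∈ W, ρ (x * y) v = ρ x v + ρ y v - v := by
    intro x hx y hy v hv
    have h : (ρ x - 1) ((ρ y - 1) v) = 0 :=
      apply_apply_eq_zero_of_finrank_le_two hW hF hsep hW0 (hρ x) (hρ y)
        (fun v hv => W.sub_mem (mem x hx v hv) hv) (fun v hv => W.sub_mem (mem y hy v hv) hv) v hv
    rw [map_mul, Module.End.mul_apply, ← sub_eq_zero, ← h]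
    simp only [LinearMap.sub_apply, Module.End.one_apply, map_sub]
    abel
  intro g hg
  induction hg using Subgroup.closure_induction with
  | mem g hg =>
    obtain ⟨x, hx, y, hy, rfl⟩ := hg
    intro v hv
    have hv' := mem _ (inv_mem (mul_mem hy hx)) v hv
    rw [show ⁅x, y⁆ = x * y * (y * x)⁻¹ by rw [commutatorElement_def]; group, map_mul,
      Module.End.mul_apply, expand x hx y hy _ hv', add_comm, ← expand y hy x hx _ hv',
      ← Module.End.mul_apply, ← map_mul, mul_inv_cancel, map_one, Module.End.one_apply]
  | one => simp
  | mul x y _ _ hx hy =>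
    intro v hv
    rw [map_mul, Module.End.mul_apply, hy v hv, hx v hv]
  | inv x _ hx =>
    intro v hv
    conv_lhs => rw [← hx v hv]
    rw [← Module.End.mul_apply, ← map_mul, inv_mul_cancel, map_one, Module.End.one_apply]

end Raising

section RankTwo

variable {ι K : Type*} [Field K]

/-- The derivations raising the order of vanishing by at least `r`. -/
def ordDer (ι K : Type*) [Field K] (r : ℕ) :
    Submodule K (Derivation K (MvPowerSeries ι K) (MvPowerSeries ι K)) where
  carrier := {D | ∀ j, ∀ u ∈ ordIdeal ι K j, D u ∈ ordIdeal ι K (j + r)}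
  zero_mem' _ _ _ := zero_mem _
  add_mem' hD hD' j u hu := add_mem (hD j u hu) (hD' j u hu)
  smul_mem' c _ hD j u hu := smul_mem_ordIdeal c (hD j u hu)

theorem ordDer_antitone : Antitone (ordDer ι K) := fun _ _ h _ hD j u hu =>
  ordIdeal_antitone (Nat.add_le_add_left h j) (hD j u hu)

theorem conjDer_sub_mem_ordDer (σ : unipotent ι K) {r : ℕ}
    {D : Derivation K (MvPowerSeries ι K) (MvPowerSeries ι K)} (hD : D ∈ ordDer ι K r) :
    conjDer σ D - D ∈ ordDer ι K (r + 1) := by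
  intro j u hu
  have split : (conjDer σ D - D) u = (σ • D (σ⁻¹ • u) - D (σ⁻¹ • u)) + D (σ⁻¹ • u - u) := by
    rw [Derivation.sub_apply, conjDer_apply, map_sub]
    abel
  rw [split, ← add_assoc]
  refine add_mem (unipotent_smul_sub_mem σ (hD j _ (unipotent_smul_mem σ⁻¹ hu))) ?_
  have h := hD _ _ (unipotent_smul_sub_mem σ⁻¹ hu)
  rwa [add_right_comm] at h

theorem iInf_ordDer [Finite ι] [CharZero K] : ⨅ r, ordDer ι K r = ⊥ := by
  refine (Submodule.eq_bot_iff _).2 fun D hD => derivation_ext_of_X fun i => ?_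
  rw [Submodule.mem_iInf] at hD
  exact eq_zero_of_forall_mem_ordIdeal fun j =>
    ordIdeal_antitone (Nat.le_add_left j 1) (hD j 1 (X i) (X_mem_ordIdeal_one i))

variable [CharZero K]

theorem logDer_mem_ordDer_zero (σ : unipotent ι K) : logDer σ ∈ ordDer ι K 0 := fun j _ hu =>
  ordIdeal_antitone j.le_succ (logDer_mem σ hu)

theorem conjDer_logDer (τ σ : unipotent ι K) : conjDer τ (logDer σ) = logDer (τ * σ * τ⁻¹) := by
  refine Derivation.ext fun u => ?_
  rw [conjDer_apply, ← logDer_conj_smul, smul_inv_smul]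

theorem logDer_injective :
    Function.Injective (logDer : unipotent ι K → Derivation K (MvPowerSeries ι K) _) :=
  fun σ τ h => fracLog_injective <| derivation_ext_of_algebraMap fun a => by
    rw [fracLog_algebraMap, fracLog_algebraMap, h]

theorem conjDer_logDer_eq_self_iff {τ σ : unipotent ι K} :
    conjDer τ (logDer σ) = logDer σ ↔ Commute τ σ := by
  rw [conjDer_logDer, logDer_injective.eq_iff, mul_inv_eq_iff_eq_mul]
  rfl

variable {p : ι → unipotent ι K}

theorem commute_of_forall_commute [Finite ι]
    (hp : LinearIndependent (FracSeries ι K) (fracLog ∘ p))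
    (hcomm : ∀ i j, Commute (p i) (p j)) {x y : unipotent ι K} (hx : ∀ i, Commute (p i) x)
    (hy : ∀ i, Commute (p i) y) : Commute x y := by
  have := Fintype.ofFinite ι
  obtain ⟨c, hc⟩ := exists_logDer_eq_sum_of_commute hp hcomm hy
  rw [← conjDer_logDer_eq_self_iff, hc, map_sum]
  exact Finset.sum_congr rfl fun i _ => by
    rw [map_smul, conjDer_logDer_eq_self_iff.2 (hx i).symm]

theorem iterCommutator_two_eq_bot_of_linearIndependent [Fintype ι] (hι : Fintype.card ι ≤ 2)
    (hp : LinearIndependent (FracSeries ι K) (fracLog ∘ p))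
    (hcomm : ∀ i j, Commute (p i) (p j)) {S : Set (unipotent ι K)}
    (hS : ∀ s ∈ S, ∀ i j, Commute (p i) (s * p j * s⁻¹)) :
    iterCommutator (Subgroup.closure S) 2 = ⊥ := by
  let W := Submodule.span K (Set.range (logDer ∘ p))
  have : FiniteDimensional K W := .span_of_finite K (Set.finite_range _)
  have hW0 : W ≤ ordDer ι K 0 := Submodule.span_le.2 <| by
    rintro _ ⟨i, rfl⟩
    exact logDer_mem_ordDer_zero (p i)
  have generator_mem : ∀ s ∈ S, ∀ D ∈ W, conjDer s D ∈ W := fun s hs =>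
    Submodule.span_le (p := W.comap (conjDer s)).2 <| by
      rintro _ ⟨j, rfl⟩
      obtain ⟨c, hc⟩ := exists_logDer_eq_sum_of_commute hp hcomm fun i => hS s hs i j
      change conjDer s (logDer (p j)) ∈ W
      rw [conjDer_logDer, hc]
      exact sum_mem fun i _ => W.smul_mem _ (Submodule.subset_span ⟨i, rfl⟩)
  have commutator_commute : ∀ x ∈ ⁅Subgroup.closure S, Subgroup.closure S⁆, ∀ i,
      Commute (p i) x := fun x hx i => (conjDer_logDer_eq_self_iff.1 <|
    apply_eq_self_of_mem_commutator ((finrank_range_le_card _).trans hι) ordDer_antitone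
      iInf_ordDer hW0 (fun g _ _ => conjDer_sub_mem_ordDer g)
      (map_eq_of_mem_closure generator_mem) x hx _ (Submodule.subset_span ⟨i, rfl⟩)).symm
  exact Subgroup.commutator_eq_bot_iff_le_centralizer.2 fun x hx y hy =>
    commute_of_forall_commute hp hcomm (commutator_commute y hy) (commutator_commute x hx)

end RankTwo

section Scaling

open scoped Pointwise commutatorElement

variable {K A G : Type*} [CommRing K] [Field A] [Algebra K A] [Group G] [MulSemiringAction G A]
  [SMulCommClass G K A] {D E : Derivation K A A} {k : Set A} {k₀ : Subfield A} {H : Subgroup G}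

theorem smul_mem_of_mem_stabilizer {g : G} (hg : g ∈ MulAction.stabilizer G k) {u : A}
    (hu : u ∈ k) : g • u ∈ k :=
  (MulAction.mem_stabilizer_set.1 hg u).2 hu

theorem conjDer_eqOn {g : G} (hg : g ∈ MulAction.stabilizer G k) (h : Set.EqOn D E k) :
    Set.EqOn (conjDer g D) (conjDer g E) k := fun u hu => by
  rw [conjDer_apply, conjDer_apply, h (smul_mem_of_mem_stabilizer (inv_mem hg) hu)]

/-- The group elements preserving `k` and `k₀` and multiplying the restriction of the derivation `D`
to `k` by a nonzero factor in `k₀`. -/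
def scaling (D : Derivation K A A) (k : Set A) (k₀ : Subfield A) : Subgroup G where
  carrier := {g | g ∈ MulAction.stabilizer G k ∧ g ∈ MulAction.stabilizer G (k₀ : Set A) ∧
    ∃ c ∈ k₀, c ≠ 0 ∧ Set.EqOn (conjDer g D) (c • D : Derivation K A A) k}
  one_mem' := ⟨one_mem _, one_mem _, 1, one_mem _, one_ne_zero, fun u _ => by simp⟩
  mul_mem' := by
    rintro g h ⟨hg, hg₀, c, hc, hc0, hgD⟩ ⟨hh, hh₀, d, hd, hd0, hhD⟩
    refine ⟨mul_mem hg hh, mul_mem hg₀ hh₀, g • d * c,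
      mul_mem (smul_mem_of_mem_stabilizer hg₀ hd) hc,
      mul_ne_zero ((smul_ne_zero_iff_ne g).2 hd0) hc0, fun u hu => ?_⟩
    rw [map_mul, Module.End.mul_apply, conjDer_eqOn hg hhD hu, conjDer_smul, Derivation.smul_apply,
      hgD hu, mul_smul]
    rfl
  inv_mem' := by
    rintro g ⟨hg, hg₀, c, hc, hc0, hgD⟩
    have hc0' : g⁻¹ • c ≠ 0 := (smul_ne_zero_iff_ne g⁻¹).2 hc0
    refine ⟨inv_mem hg, inv_mem hg₀, (g⁻¹ • c)⁻¹,
      inv_mem (smul_mem_of_mem_stabilizer (inv_mem hg₀) hc), inv_ne_zero hc0', fun u hu => ?_⟩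
    have h := conjDer_eqOn (inv_mem hg) hgD hu
    rw [← Module.End.mul_apply, ← map_mul, inv_mul_cancel, map_one, Module.End.one_apply,
      conjDer_smul] at h
    rw [Derivation.smul_apply, h, Derivation.smul_apply, inv_smul_smul₀ hc0']

/-- The group elements preserving `k` and commuting with the restriction of the derivation `D`
to `k`. -/
def commuting (D : Derivation K A A) (k : Set A) : Subgroup G where
  carrier := {g | g ∈ MulAction.stabilizer G k ∧ Set.EqOn (conjDer g D) D k}
  one_mem' := ⟨one_mem _, fun u _ => by rw [map_one, Module.End.one_apply]⟩
  mul_mem' := fun {g h} ⟨hg, hgD⟩ ⟨hh, hhD⟩ => ⟨mul_mem hg hh, fun u hu => by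
    rw [map_mul, Module.End.mul_apply, conjDer_eqOn hg hhD hu, hgD hu]⟩
  inv_mem' := fun {g} ⟨hg, hgD⟩ => ⟨inv_mem hg, fun u hu => by
    rw [← conjDer_eqOn (inv_mem hg) hgD hu, ← Module.End.mul_apply, ← map_mul, inv_mul_cancel,
      map_one, Module.End.one_apply]⟩

theorem commutator_le_commuting (hH : H ≤ scaling D k k₀)
    (hH₀ : H ≤ fixingSubgroup G (k₀ : Set A)) : ⁅H, H⁆ ≤ commuting D k := by
  have fix {g : G} (hg : g ∈ H) {c : A} (hc : c ∈ k₀) : g • c = c :=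
    (mem_fixingSubgroup_iff G).1 (hH₀ hg) c hc
  refine Subgroup.commutator_le.2 fun g hg h hh => ?_
  obtain ⟨hgk, -, c, hc, hc0, hgD⟩ := hH hg
  obtain ⟨hhk, -, d, hd, hd0, hhD⟩ := hH hh
  have hz : ⁅g, h⁆ ∈ H := Subgroup.commutator_le_self H (Subgroup.commutator_mem_commutator hg hh)
  refine ⟨(hH hz).1, fun u hu => mul_left_cancel₀ (mul_ne_zero hc0 hd0) ?_⟩
  have conj_hg : Set.EqOn (conjDer (h * g) D) ((c * d) • D : Derivation K A A) k := fun u hu => by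
    rw [map_mul, Module.End.mul_apply, conjDer_eqOn hhk hgD hu, conjDer_smul, fix hh hc, mul_smul,
      Derivation.smul_apply, hhD hu]
    rfl
  have conj_gh : Set.EqOn (conjDer (g * h) D) ((c * d) • D : Derivation K A A) k := fun u hu => by
    rw [map_mul, Module.End.mul_apply, conjDer_eqOn hgk hhD hu, conjDer_smul, fix hg hd, mul_comm,
      mul_smul, Derivation.smul_apply, hgD hu]
    rfl
  have h_conj := conjDer_eqOn (hH hz).1 conj_hg hu
  rw [← Module.End.mul_apply, ← map_mul, show ⁅g, h⁆ * (h * g) = g * h by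
    rw [commutatorElement_def]; group, conj_gh hu, conjDer_smul, fix hz (mul_mem hc hd)] at h_conj
  exact h_conj.symm

end Scaling

section RankOne

open scoped Pointwise commutatorElement

variable {ι K : Type*} [Field K]

theorem algebraMap_fieldRange_le_fixingSubgroup (H : Subgroup (unipotent ι K)) :
    H ≤ fixingSubgroup _ ((algebraMap K (FracSeries ι K)).fieldRange : Set (FracSeries ι K)) := by
  rintro g - ⟨_, c, rfl⟩
  exact smul_algebraMap g c

variable [CharZero K] {γ δ η τ : unipotent ι K}

/-- The first integrals of the foliation generated by `γ`. They form a subfield, which is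
`FixedBy.subfield _ γ`. -/
abbrev firstIntegrals (γ : unipotent ι K) : Set (FracSeries ι K) :=
  MulAction.fixedBy _ γ

theorem mem_commuting_univ_iff : τ ∈ commuting (fracLog γ) Set.univ ↔ Commute τ γ := by
  rw [← conjDer_fracLog_eq_self_iff]
  refine ⟨fun h => Derivation.ext fun u => h.2 trivial, fun h => ⟨?_, fun u _ => by rw [h]⟩⟩
  exact MulAction.mem_stabilizer_set.2 fun _ => Iff.rfl

theorem eqOn_conjDer_fracLog_iff {k : Set (FracSeries ι K)}
    (hη : η ∈ MulAction.stabilizer (unipotent ι K) k) (hk : ∀ u ∈ k, fracLog η u ∈ k) :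
    Set.EqOn (conjDer τ (fracLog η)) (fracLog η) k ↔ ⁅τ, η⁆ ∈ fixingSubgroup _ k := by
  have smul_mem : ∀ u ∈ k, η • u ∈ k := fun u => smul_mem_of_mem_stabilizer hη
  have log_eqOn_iff : Set.EqOn (fracLog (τ * η * τ⁻¹)) (fracLog η) k ↔
      Set.EqOn (η • ·) ((τ * η * τ⁻¹) • ·) k :=
    ⟨fun h => smul_eqOn_of_fracLog_eqOn hk h.symm,
      fun h => (fracLog_eqOn_of_smul_eqOn smul_mem h).symm⟩
  rw [← fracLog_conj, log_eqOn_iff, mem_fixingSubgroup_iff]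
  refine ⟨fun h u hu => ?_, fun h u hu => ?_⟩
  · have h_smul := h (smul_mem_of_mem_stabilizer (inv_mem hη) hu)
    simp only [smul_inv_smul] at h_smul
    rw [commutatorElement_def, mul_smul]
    exact h_smul.symm
  · have h_smul := h _ (smul_mem u hu)
    rw [← mul_smul, commutatorElement_def, inv_mul_cancel_right] at h_smul
    exact h_smul.symm

theorem fracLog_mem_firstIntegrals
    (hδ : δ ∈ MulAction.stabilizer _ (firstIntegrals γ)) :
    ∀ u ∈ firstIntegrals γ, fracLog δ u ∈ firstIntegrals γ :=
  fun _ => fracLog_mem_fixedBy fun _ => smul_mem_of_mem_stabilizer hδ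

theorem fracLog_ne_zero (hγ : γ ≠ 1) : fracLog γ ≠ 0 := fun h =>
  hγ (fracLog_injective (h.trans fracLog_one.symm))

theorem linearIndependent_pair_or_exists_smul (hγ : γ ≠ 1) (τ : unipotent ι K) :
    LinearIndependent (FracSeries ι K) (fracLog ∘ ![γ, τ]) ∨
      ∃ a : FracSeries ι K, fracLog τ = a • fracLog γ := by
  by_contra! h
  refine h.1 ?_
  have pair := (LinearIndependent.pair_iff' (fracLog_ne_zero hγ)).2 fun a ha => h.2 a ha.symm
  rwa [show ![fracLog γ, fracLog τ] = fracLog ∘ ![γ, τ] by ext1 i; fin_cases i <;> rfl] at pair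

theorem smul_eq_of_fracLog_eq_smul (hγ : γ ≠ 1) {a : FracSeries ι K}
    (h : fracLog τ = a • fracLog γ) (hδγ : Commute δ γ) (hδτ : Commute δ τ) : δ • a = a := by
  have h_conj := congrArg (conjDer δ) h
  rw [conjDer_smul, conjDer_fracLog_eq_self_iff.2 hδγ, conjDer_fracLog_eq_self_iff.2 hδτ, h]
    at h_conj
  exact (smul_left_injective _ (fracLog_ne_zero hγ) h_conj).symm

theorem mem_scaling_of_fracLog_conj_eq_smul (hγ : γ ≠ 1) {s : unipotent ι K}
    (hs : Commute γ (s * γ * s⁻¹)) {c : FracSeries ι K}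
    (h : fracLog (s * γ * s⁻¹) = c • fracLog γ) :
    s ∈ scaling (fracLog γ) Set.univ (FixedBy.subfield _ γ) := by
  have hc : c ≠ 0 := by
    rintro rfl
    rw [zero_smul] at h
    exact fracLog_ne_zero (fun h => hγ (conj_eq_one_iff.1 h)) h
  refine ⟨MulAction.mem_stabilizer_set.2 fun _ => Iff.rfl, ?_, c,
    smul_eq_of_fracLog_eq_smul hγ h (.refl γ) hs, hc, fun u _ => by rw [← fracLog_conj, h]⟩
  change s • firstIntegrals γ = firstIntegrals γ
  ext u
  rw [MulAction.smul_fixedBy, MulAction.mem_fixedBy, MulAction.mem_fixedBy,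
    smul_eq_self_iff_fracLog_eq_zero, smul_eq_self_iff_fracLog_eq_zero, h, Derivation.smul_apply,
    smul_eq_zero_iff_right hc]

variable {γ η δ x y : unipotent (Fin 2) K}

theorem commute_of_mem_fixingSubgroup (hγ : γ ≠ 1)
    (hx : x ∈ fixingSubgroup _ (firstIntegrals γ))
    (hy : y ∈ fixingSubgroup _ (firstIntegrals γ))
    (hxγ : Commute x γ) (hyγ : Commute y γ) : Commute x y := by
  rcases linearIndependent_pair_or_exists_smul hγ x with hp | ⟨a, ha⟩
  · obtain ⟨c, hc⟩ := exists_fracLog_eq_sum hp y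
    have coeff_fixed (i) : x • c i = c i := hx ⟨c i, smul_eq_of_commute hp hc hyγ.symm
      (Fin.forall_fin_two.2 ⟨.refl γ, hxγ.symm⟩) i⟩
    rw [← conjDer_fracLog_eq_self_iff, hc, map_sum]
    refine Finset.sum_congr rfl fun i _ => ?_
    rw [conjDer_smul, coeff_fixed, conjDer_fracLog_eq_self_iff.2]
    exact Fin.forall_fin_two (p := fun i => Commute x (![γ, x] i)).2 ⟨hxγ, .refl x⟩ i
  · refine (conjDer_fracLog_eq_self_iff.1 ?_).symm
    rw [ha, conjDer_smul, conjDer_fracLog_eq_self_iff.2 hyγ,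
      hy ⟨a, smul_eq_of_fracLog_eq_smul hγ ha (.refl γ) hxγ.symm⟩]

theorem iterCommutator_two_inf_fixingSubgroup_eq_bot (hγ : γ ≠ 1)
    {H : Subgroup (unipotent (Fin 2) K)}
    (hH : H ≤ scaling (fracLog γ) Set.univ (FixedBy.subfield _ γ)) :
    iterCommutator (H ⊓ fixingSubgroup _ (firstIntegrals γ)) 2 = ⊥ := by
  set N := fixingSubgroup (unipotent (Fin 2) K) (firstIntegrals γ)
  have commute_γ : ∀ x ∈ ⁅H ⊓ N, H ⊓ N⁆, Commute x γ := fun x hx => mem_commuting_univ_iff.1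
    (commutator_le_commuting (inf_le_left.trans hH) inf_le_right hx)
  have mem_N : ∀ x ∈ ⁅H ⊓ N, H ⊓ N⁆, x ∈ N := fun x hx => (Subgroup.commutator_le_self _ hx).2
  exact Subgroup.commutator_eq_bot_iff_le_centralizer.2 fun x hx y hy =>
    commute_of_mem_fixingSubgroup hγ (mem_N y hy) (mem_N x hx) (commute_γ y hy) (commute_γ x hx)

theorem exists_fracLog_eqOn_const_smul (hγ : γ ≠ 1)
    (hη : η ∈ MulAction.stabilizer _ (firstIntegrals γ))
    (hδ : δ ∈ MulAction.stabilizer _ (firstIntegrals γ))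
    (hη' : η ∉ fixingSubgroup _ (firstIntegrals γ))
    (hηδ : ⁅η, δ⁆ ∈ fixingSubgroup _ (firstIntegrals γ)) :
    ∃ c : K, Set.EqOn (fracLog δ) (c • fracLog η : Derivation K (FracSeries (Fin 2) K) _)
      (firstIntegrals γ) := by
  set k := firstIntegrals γ
  have log_γ : ∀ u ∈ k, fracLog γ u = 0 := fun u => smul_eq_self_iff_fracLog_eq_zero.1
  obtain ⟨u₀, hu₀, hηu₀⟩ : ∃ u ∈ k, fracLog η u ≠ 0 := by
    by_contra! h
    exact hη' ((mem_fixingSubgroup_iff _).2 fun u hu =>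
      smul_eq_self_iff_fracLog_eq_zero.2 (h u hu))
  have hp := (linearIndependent_pair_or_exists_smul hγ η).resolve_right fun ⟨a, ha⟩ => hηu₀ <| by
    rw [ha, Derivation.smul_apply, log_γ u₀ hu₀, smul_zero]
  obtain ⟨c, hc⟩ := exists_fracLog_eq_sum hp δ
  have log_δ : Set.EqOn (fracLog δ) (c 1 • fracLog η : Derivation K (FracSeries (Fin 2) K) _) k :=
    fun u hu => by
      rw [hc, Fin.sum_univ_two, Derivation.add_apply, Derivation.smul_apply]
      change c 0 • fracLog γ u + _ = _
      rw [log_γ u hu, smul_zero, zero_add]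
      rfl
  have smul_c : ∀ i, ![γ, η] i • c 1 = c 1 := Fin.forall_fin_two.2 ⟨?_, ?_⟩
  · obtain ⟨d, hd⟩ := mem_range_algebraMap_base_of_forall_smul_eq hp smul_c
    refine ⟨d, fun u hu => ?_⟩
    rw [log_δ hu, ← hd]
    exact algebraMap_smul (FracSeries (Fin 2) K) d (fracLog η u)
  · change c 1 ∈ FixedBy.subfield _ γ
    rw [eq_div_of_mul_eq hηu₀ (log_δ hu₀).symm]
    exact div_mem (fracLog_mem_firstIntegrals hδ u₀ hu₀)
      (fracLog_mem_firstIntegrals hη u₀ hu₀)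
  · have h := (eqOn_conjDer_fracLog_iff hδ (fracLog_mem_firstIntegrals hδ)).2 hηδ hu₀
    rw [conjDer_eqOn hη log_δ hu₀, conjDer_smul, conjDer_fracLog_eq_self_iff.2 (.refl η),
      log_δ hu₀] at h
    exact mul_right_cancel₀ hηu₀ h

theorem mem_scaling_of_commutator_conj_mem (hγ : γ ≠ 1)
    (hη : η ∈ MulAction.stabilizer _ (firstIntegrals γ))
    (hη' : η ∉ fixingSubgroup _ (firstIntegrals γ)) {s : unipotent (Fin 2) K}
    (hs : s ∈ MulAction.stabilizer _ (firstIntegrals γ))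
    (h : ⁅η, s * η * s⁻¹⁆ ∈ fixingSubgroup _ (firstIntegrals γ)) :
    s ∈ scaling (fracLog η) (firstIntegrals γ)
      (algebraMap K (FracSeries (Fin 2) K)).fieldRange := by
  obtain ⟨c, hc⟩ :=
    exists_fracLog_eqOn_const_smul hγ hη (mul_mem (mul_mem hs hη) (inv_mem hs)) hη' h
  refine ⟨hs, ?_, algebraMap K _ c, ⟨c, rfl⟩, ?_, fun u hu => ?_⟩
  · exact MulAction.fixingSubgroup_le_stabilizer _ _
      (algebraMap_fieldRange_le_fixingSubgroup ⊤ trivial)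
  · rintro h0
    refine hη' ((mem_fixingSubgroup_iff _).2 fun u hu => ?_)
    have log_eq := hc (smul_mem_of_mem_stabilizer hs hu)
    rw [(_root_.map_eq_zero _).1 h0, zero_smul, Derivation.zero_apply, fracLog_conj, conjDer_apply,
      inv_smul_smul, smul_eq_zero_iff_eq] at log_eq
    exact smul_eq_self_iff_fracLog_eq_zero.2 log_eq
  · rw [← fracLog_conj, hc hu, Derivation.smul_apply, Derivation.smul_apply, algebraMap_smul]

theorem iterCommutator_two_closure_le_fixingSubgroup (hγ : γ ≠ 1) {S : Set (unipotent (Fin 2) K)}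
    (hS : Subgroup.closure S ≤ MulAction.stabilizer _ (firstIntegrals γ))
    (hη : η ∈ MulAction.stabilizer _ (firstIntegrals γ))
    (hη' : η ∉ fixingSubgroup _ (firstIntegrals γ))
    (h : ∀ s ∈ S, ⁅η, s * η * s⁻¹⁆ ∈ fixingSubgroup _ (firstIntegrals γ)) :
    iterCommutator (Subgroup.closure S) 2 ≤ fixingSubgroup _ (firstIntegrals γ) := by
  set Γ := Subgroup.closure S
  have le_scaling : Γ ≤ scaling (fracLog η) (firstIntegrals γ)
      (algebraMap K (FracSeries (Fin 2) K)).fieldRange := (Subgroup.closure_le _).2 fun s hs =>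
    mem_scaling_of_commutator_conj_mem hγ hη hη' (hS (Subgroup.subset_closure hs)) (h s hs)
  have conj_log_η (x) (hx : x ∈ ⁅Γ, Γ⁆) :
      Set.EqOn (conjDer x (fracLog η)) (fracLog η) (firstIntegrals γ) :=
    (commutator_le_commuting le_scaling (algebraMap_fieldRange_le_fixingSubgroup Γ) hx).2
  refine Subgroup.commutator_le.2 fun y hy x hx => ?_
  have hxk := hS (Subgroup.commutator_le_self _ hx)
  have hyk := hS (Subgroup.commutator_le_self _ hy)
  obtain ⟨c, hc⟩ := exists_fracLog_eqOn_const_smul hγ hη hxk hη' <| by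
    rw [← commutatorElement_inv]
    exact inv_mem <|
      (eqOn_conjDer_fracLog_iff hη (fracLog_mem_firstIntegrals hη)).1 (conj_log_η x hx)
  refine (eqOn_conjDer_fracLog_iff hxk (fracLog_mem_firstIntegrals hxk)).1 fun u hu => ?_
  rw [conjDer_eqOn hyk hc hu, map_smul, Derivation.smul_apply, conj_log_η y hy hu, hc hu,
    Derivation.smul_apply]

theorem iterCommutator_two_closure_le_of_iterCommutator_four_le (hγ : γ ≠ 1)
    {S : Set (unipotent (Fin 2) K)}
    (hS : Subgroup.closure S ≤ MulAction.stabilizer _ (firstIntegrals γ))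
    (h : iterCommutator (Subgroup.closure (conjCommutators S 8)) 4 ≤
      fixingSubgroup _ (firstIntegrals γ)) :
    iterCommutator (Subgroup.closure S) 2 ≤ fixingSubgroup _ (firstIntegrals γ) := by
  have normalizes : Subgroup.closure S ≤
      Subgroup.normalizer (fixingSubgroup (unipotent (Fin 2) K) (firstIntegrals γ)) := fun g hg =>
    Subgroup.mem_normalizer_iff_map_conj_eq.2 (SubMulAction.fixingSubgroup_map_conj_eq (hS hg))
  rcases iterCommutator_one_le_or_exists_monotone (d := 4) normalizes h with
    hle | ⟨A, hA, hA_le, hA_conj, hA0, hA2⟩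
  · exact (iterCommutator_antitone _ one_le_two).trans hle
  obtain ⟨η, hη, hη'⟩ := SetLike.not_le_iff_exists.1 hA0
  exact iterCommutator_two_closure_le_fixingSubgroup hγ hS (hS (hA_le 0 hη)) hη' fun s hs =>
    hA2 <| Subgroup.commutator_mem_commutator (hA zero_le_two hη)
      (hA one_le_two (hA_conj s hs 0 η hη))

theorem iterCommutator_four_closure_eq_bot {S : Set (unipotent (Fin 2) K)}
    (h : iterCommutator (Subgroup.closure (conjCommutators S 8)) 4 = ⊥) :
    iterCommutator (Subgroup.closure S) 4 = ⊥ := by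
  have normalizes : Subgroup.closure S ≤
      Subgroup.normalizer ((⊥ : Subgroup (unipotent (Fin 2) K)) : Set _) := by
    rw [Subgroup.normalizer_eq_top]
    exact le_top
  rcases iterCommutator_one_le_or_exists_monotone (d := 4) normalizes h.le with
    hle | ⟨A, hA, -, hA_conj, hA0, hA2⟩
  · exact le_bot_iff.1 ((iterCommutator_antitone _ (by norm_num)).trans hle)
  have commute : ∀ x ∈ A 2, ∀ y ∈ A 2, Commute x y := fun x hx y hy =>
    commutatorElement_eq_one_iff_commute.1 (hA2 (Subgroup.commutator_mem_commutator hx hy))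
  obtain ⟨γ, hγA, hγ : γ ≠ 1⟩ := SetLike.not_le_iff_exists.1 hA0
  by_cases hrank : ∃ τ ∈ A 1, LinearIndependent (FracSeries (Fin 2) K) (fracLog ∘ ![γ, τ])
  · obtain ⟨τ, hτA, hp⟩ := hrank
    have mem : ∀ i, ![γ, τ] i ∈ A 1 := Fin.forall_fin_two.2 ⟨hA zero_le_one hγA, hτA⟩
    refine le_bot_iff.1 ((iterCommutator_antitone _ (by norm_num)).trans
      (iterCommutator_two_eq_bot_of_linearIndependent (Fintype.card_fin 2).le hp (fun i j =>
        commute _ (hA one_le_two (mem i)) _ (hA one_le_two (mem j))) fun s hs i j =>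
        commute _ (hA one_le_two (mem i)) _ (hA_conj s hs 1 _ (mem j))).le)
  · push Not at hrank
    have le_scaling : Subgroup.closure S ≤
        scaling (fracLog γ) Set.univ (FixedBy.subfield _ γ) := by
      refine (Subgroup.closure_le _).2 fun s hs => ?_
      obtain ⟨c, hc⟩ := (linearIndependent_pair_or_exists_smul hγ _).resolve_left
        (hrank _ (hA_conj s hs 0 γ hγA))
      exact mem_scaling_of_fracLog_conj_eq_smul hγ
        (commute _ (hA zero_le_two hγA) _ (hA one_le_two (hA_conj s hs 0 γ hγA))) hc
    have le_fixing := iterCommutator_two_closure_le_of_iterCommutator_four_le hγ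
      (fun g hg => (le_scaling hg).2.1) (h.le.trans bot_le)
    rw [iterCommutator_add _ 2 2, ← le_bot_iff,
      ← iterCommutator_two_inf_fixingSubgroup_eq_bot hγ le_scaling]
    exact iterCommutator_mono (le_inf (iterCommutator_antitone _ zero_le_two) le_fixing) 2

end RankOne

section TaylorSeries

open Asymptotics

variable {𝕜 ι : Type*} [RCLike 𝕜] [Fintype ι]

section Order

variable {E F : Type*} [NormedAddCommGroup E] [NormedSpace 𝕜 E] [NormedAddCommGroup F]
  [NormedSpace 𝕜 F]

theorem isBigO_norm_pow_of_le {i j : ℕ} (h : i ≤ j) :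
    (fun x : E => ‖x‖ ^ j) =O[𝓝 0] fun x => ‖x‖ ^ i := by
  rcases h.eq_or_lt with rfl | h
  · exact isBigO_refl _ _
  · exact (isLittleO_norm_pow_norm_pow h).isBigO

theorem isBigO_apply {α : Type*} {l : Filter α} (g : α → EuclideanSpace 𝕜 ι) (i : ι) :
    (fun x => g x i) =O[l] g :=
  isBigO_of_le _ fun x => PiLp.norm_apply_le (g x) i

theorem eq_zero_of_isBigO_of_homogeneous {f : E → F} {j : ℕ}
    (hf : ∀ (t : 𝕜) x, f (t • x) = t ^ j • f x)
    (h : f =O[𝓝 0] fun x => ‖x‖ ^ (j + 1)) (x : E) : f x = 0 := by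
  obtain ⟨c, hc⟩ := h.bound
  have smul_tendsto : Tendsto (fun t : 𝕜 => t • x) (𝓝[≠] 0) (𝓝 0) :=
    (Continuous.tendsto' (by fun_prop) 0 0 (zero_smul 𝕜 x)).mono_left nhdsWithin_le_nhds
  have bound_tendsto : Tendsto (fun t : 𝕜 => c * ‖x‖ ^ (j + 1) * ‖t‖) (𝓝[≠] 0) (𝓝 0) :=
    (Continuous.tendsto' (by fun_prop) 0 0 (by simp)).mono_left nhdsWithin_le_nhds
  refine norm_le_zero_iff.1 (ge_of_tendsto bound_tendsto ?_)
  filter_upwards [smul_tendsto.eventually hc, self_mem_nhdsWithin] with t ht ht0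
  refine le_of_mul_le_mul_left ?_ (pow_pos (norm_pos_iff.2 ht0) j)
  rw [hf, norm_smul, norm_pow, norm_pow, norm_norm, norm_smul] at ht
  exact ht.trans_eq (by ring)

theorem isBigO_eval_of_mem_ordIdeal {P : MvPolynomial ι 𝕜} {j : ℕ}
    (h : (P : MvPowerSeries ι 𝕜) ∈ ordIdeal ι 𝕜 j) :
    (fun x : EuclideanSpace 𝕜 ι => MvPolynomial.eval x.ofLp P) =O[𝓝 0] fun x => ‖x‖ ^ j := by
  simp only [MvPolynomial.eval_eq']
  refine IsBigO.fun_sum fun d hd => IsBigO.const_mul_left ?_ _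
  have hj : j ≤ d.degree := by
    contrapose! hd
    rw [MvPolynomial.notMem_support_iff, ← MvPolynomial.coeff_coe]
    exact mem_ordIdeal_iff_coeff.1 h d hd
  refine IsBigO.trans ?_ (isBigO_norm_pow_of_le hj)
  simp only [Finsupp.degree_eq_sum, ← Finset.prod_pow_eq_pow_sum]
  exact IsBigO.finsetProd fun i _ => ((isBigO_apply id i).norm_right).pow (d i)

theorem eval_smul_of_isHomogeneous {R σ : Type*} [CommSemiring R] {P : MvPolynomial σ R} {j : ℕ}
    (hP : P.IsHomogeneous j) (t : R) (x : σ → R) :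
    MvPolynomial.eval (t • x) P = t ^ j • MvPolynomial.eval x P := by
  simp only [MvPolynomial.eval_eq, Pi.smul_apply, smul_eq_mul, mul_pow, Finset.prod_mul_distrib,
    Finset.prod_pow_eq_pow_sum, Finset.mul_sum, ← Finsupp.degree_apply]
  refine Finset.sum_congr rfl fun d hd => ?_
  have degree_eq : d.degree = j := by
    rw [← hP (MvPolynomial.mem_support_iff.1 hd), Finsupp.degree_eq_weight_one]
    rfl
  rw [degree_eq]
  ring

theorem mem_ordIdeal_of_isBigO_eval {P : MvPolynomial ι 𝕜} {j : ℕ}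
    (h : (fun x : EuclideanSpace 𝕜 ι => MvPolynomial.eval x.ofLp P) =O[𝓝 0] fun x => ‖x‖ ^ j) :
    (P : MvPowerSeries ι 𝕜) ∈ ordIdeal ι 𝕜 j := by
  induction j with
  | zero => exact mem_ordIdeal_zero _
  | succ j ih =>
    have hj := mem_ordIdeal_iff_coeff.1 (ih (h.trans (isBigO_norm_pow_of_le j.le_succ)))
    set H := MvPolynomial.homogeneousComponent j P with H_def
    have sub_mem : ((P - H : MvPolynomial ι 𝕜) : MvPowerSeries ι 𝕜) ∈ ordIdeal ι 𝕜 (j + 1) := by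
      refine mem_ordIdeal_iff_coeff.2 fun d hd => ?_
      rw [MvPolynomial.coeff_coe, MvPolynomial.coeff_sub, H_def,
        MvPolynomial.coeff_homogeneousComponent]
      split_ifs with hdj
      · exact sub_self _
      · rw [sub_zero, ← MvPolynomial.coeff_coe]
        exact hj d (lt_of_le_of_ne (Nat.le_of_lt_succ hd) hdj)
    have isBigO_H : (fun x : EuclideanSpace 𝕜 ι => MvPolynomial.eval x.ofLp H) =O[𝓝 0]
        fun x => ‖x‖ ^ (j + 1) :=
      (h.sub (isBigO_eval_of_mem_ordIdeal sub_mem)).congr_left fun x => by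
        rw [map_sub, sub_sub_cancel]
    have H_eq_zero : H = 0 := MvPolynomial.funext fun x => by
      rw [map_zero]
      exact eq_zero_of_isBigO_of_homogeneous (fun t x => eval_smul_of_isHomogeneous
        (MvPolynomial.homogeneousComponent_isHomogeneous j P) t x.ofLp) isBigO_H (WithLp.toLp 2 x)
    rwa [H_eq_zero, sub_zero] at sub_mem

theorem exists_polynomial_of_multilinear {κ : Type*} [Finite κ] (n : ℕ)
    (p : EuclideanSpace 𝕜 κ [×n]→L[𝕜] 𝕜) :
    ∃ Q : MvPolynomial κ 𝕜, Q.IsHomogeneous n ∧ ∀ x, MvPolynomial.eval x.ofLp Q = p fun _ => x := by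
  have := Fintype.ofFinite κ
  let e : κ → EuclideanSpace 𝕜 κ := EuclideanSpace.basisFun κ 𝕜
  refine ⟨∑ s : Fin n → κ, MvPolynomial.C (p fun i => e (s i)) * ∏ i, MvPolynomial.X (s i),
    MvPolynomial.IsHomogeneous.sum _ _ _ fun s _ => ?_, fun x => ?_⟩
  · simpa using (MvPolynomial.isHomogeneous_C κ (p fun i => e (s i))).mul
      (MvPolynomial.IsHomogeneous.prod Finset.univ _ (fun _ => 1) fun i _ =>
        MvPolynomial.isHomogeneous_X 𝕜 (s i))
  · calc MvPolynomial.eval x.ofLp _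
        = ∑ s : Fin n → κ, p fun i => x (s i) • e (s i) := by
          simp [p.map_smul_univ, mul_comm]
      _ = p fun _ => ∑ i, x i • e i := (p.map_sum fun _ i => x i • e i).symm
      _ = p fun _ => x := by
          congr! with _
          exact (EuclideanSpace.basisFun κ 𝕜).sum_repr x

end Order

/-- The power series `U` is the Taylor series of `u` at the origin, in the sense that its
truncations approximate `u` to all orders; `u` need not be analytic. -/
def HasTaylorSeries (u : EuclideanSpace 𝕜 ι → 𝕜) (U : MvPowerSeries ι 𝕜) : Prop :=
  ∀ j, (fun x => u x - MvPolynomial.eval x.ofLp (truncTotal j U)) =O[𝓝 0] fun x => ‖x‖ ^ j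

namespace HasTaylorSeries

variable {u v : EuclideanSpace 𝕜 ι → 𝕜} {U W : MvPowerSeries ι 𝕜}

theorem of_forall_exists (h : ∀ j, ∃ P : MvPolynomial ι 𝕜,
    ((fun x => u x - MvPolynomial.eval x.ofLp P) =O[𝓝 0] fun x => ‖x‖ ^ j) ∧
      U - P ∈ ordIdeal ι 𝕜 j) : HasTaylorSeries u U := fun j => by
  obtain ⟨P, hu, hU⟩ := h j
  have hP : ((P - truncTotal j U : MvPolynomial ι 𝕜) : MvPowerSeries ι 𝕜) ∈ ordIdeal ι 𝕜 j := by
    have coe_sub : ((P - truncTotal j U : MvPolynomial ι 𝕜) : MvPowerSeries ι 𝕜) =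
        P - truncTotal j U :=
      map_sub MvPolynomial.coeToMvPowerSeries.ringHom P (truncTotal j U)
    rw [coe_sub, ← sub_sub_sub_cancel_left]
    exact sub_mem (sub_truncTotal_mem_ordIdeal U j) hU
  exact (hu.add (isBigO_eval_of_mem_ordIdeal hP)).congr_left fun x => by
    rw [map_sub, sub_add_sub_cancel]

theorem congr (h : HasTaylorSeries u U) (huv : u =ᶠ[𝓝 0] v) : HasTaylorSeries v U := fun j =>
  (h j).congr' (huv.sub EventuallyEq.rfl) EventuallyEq.rfl

theorem eval (P : MvPolynomial ι 𝕜) :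
    HasTaylorSeries (fun x => MvPolynomial.eval x.ofLp P) P :=
  of_forall_exists fun j => ⟨P, by simpa using isBigO_zero _ _, by simp⟩

theorem apply (i : ι) : HasTaylorSeries (fun x : EuclideanSpace 𝕜 ι => x i) (X i) := by
  simpa using eval (MvPolynomial.X i : MvPolynomial ι 𝕜)

theorem add (hu : HasTaylorSeries u U) (hv : HasTaylorSeries v W) :
    HasTaylorSeries (fun x => u x + v x) (U + W) := fun j =>
  ((hu j).add (hv j)).congr_left fun x => by simp only [map_add]; ring

theorem sub (hu : HasTaylorSeries u U) (hv : HasTaylorSeries v W) :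
    HasTaylorSeries (fun x => u x - v x) (U - W) := fun j =>
  ((hu j).sub (hv j)).congr_left fun x => by simp only [map_sub]; ring

theorem isBigO_one (hu : HasTaylorSeries u U) :
    u =O[𝓝 0] fun _ => (1 : ℝ) := by
  simpa using (hu 0).add (isBigO_eval_of_mem_ordIdeal (P := truncTotal 0 U) (mem_ordIdeal_zero _))

theorem mul (hu : HasTaylorSeries u U) (hv : HasTaylorSeries v W) :
    HasTaylorSeries (fun x => u x * v x) (U * W) :=
  of_forall_exists fun j => by
    refine ⟨truncTotal j U * truncTotal j W, ?_, ?_⟩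
    · have left := (hu j).mul hv.isBigO_one
      have right := (eval (truncTotal j U)).isBigO_one.mul (hv j)
      simp only [mul_one, one_mul] at left right
      exact (left.add right).congr_left fun x => by rw [map_mul]; ring
    · rw [MvPolynomial.coe_mul, ← sub_add_sub_cancel _ (_ * W), ← sub_mul, ← mul_sub]
      exact add_mem (Ideal.mul_mem_right _ _ (sub_truncTotal_mem_ordIdeal U j))
        (Ideal.mul_mem_left _ _ (sub_truncTotal_mem_ordIdeal W j))

theorem isBigO_iff (hu : HasTaylorSeries u U) {j : ℕ} :
    (u =O[𝓝 0] fun x => ‖x‖ ^ j) ↔ U ∈ ordIdeal ι 𝕜 j := by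
  have hU := sub_truncTotal_mem_ordIdeal U j
  refine ⟨fun h => ?_, fun h => ?_⟩
  · have := mem_ordIdeal_of_isBigO_eval ((h.sub (hu j)).congr_left fun x => sub_sub_cancel _ _)
    exact sub_add_cancel U _ ▸ add_mem hU this
  · have := isBigO_eval_of_mem_ordIdeal (sub_sub_cancel U _ ▸ sub_mem h hU)
    exact ((hu j).add this).congr_left fun x => sub_add_cancel _ _

theorem unique (hU : HasTaylorSeries u U) (hW : HasTaylorSeries u W) : U = W :=
  sub_eq_zero.1 <| eq_zero_of_forall_mem_ordIdeal fun j =>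
    (hU.sub hW).isBigO_iff.1 (by simpa using isBigO_zero _ _)

theorem mem_ordIdeal_one {g : EuclideanSpace 𝕜 ι → EuclideanSpace 𝕜 ι} {i : ι}
    (hg : HasTaylorSeries (fun x => g x i) U) (hg0 : g =O[𝓝 0] fun x => x) :
    U ∈ ordIdeal ι 𝕜 1 :=
  hg.isBigO_iff.1 <| by simpa using ((isBigO_apply g i).trans hg0).norm_right

section Comp

variable {g : EuclideanSpace 𝕜 ι → EuclideanSpace 𝕜 ι}
  {σ : MvPowerSeries ι 𝕜 →ₐ[𝕜] MvPowerSeries ι 𝕜}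

theorem eval_comp (hg : ∀ i, HasTaylorSeries (fun x => g x i) (σ (X i))) (P : MvPolynomial ι 𝕜) :
    HasTaylorSeries (fun x => MvPolynomial.eval (g x).ofLp P) (σ P) := by
  induction P using MvPolynomial.induction_on with
  | C a =>
    rw [MvPolynomial.coe_C, c_eq_algebraMap, AlgHom.commutes, ← c_eq_algebraMap]
    simpa using eval (MvPolynomial.C a : MvPolynomial ι 𝕜)
  | add P Q hP hQ => simpa using hP.add hQ
  | mul_X P i hP => simpa using hP.mul (hg i)

theorem comp (hu : HasTaylorSeries u U) (hg : ∀ i, HasTaylorSeries (fun x => g x i) (σ (X i)))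
    (hg0 : g =O[𝓝 0] fun x => x) : HasTaylorSeries (fun x => u (g x)) (σ U) := by
  have g_tendsto : Tendsto g (𝓝 0) (𝓝 0) := hg0.trans_tendsto tendsto_id
  refine of_forall_exists fun j => ⟨truncTotal j (σ (truncTotal j U)), ?_, ?_⟩
  · refine ((((hu j).comp_tendsto g_tendsto).trans (hg0.norm_norm.pow j)).add
      (eval_comp hg (truncTotal j U) j)).congr_left fun x => ?_
    exact sub_add_sub_cancel _ _ _
  · rw [← sub_add_sub_cancel _ (σ (truncTotal j U : MvPolynomial ι 𝕜)), ← map_sub]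
    exact add_mem (map_mem_ordIdeal_of_X (fun i => (hg i).mem_ordIdeal_one hg0) j _
      (sub_truncTotal_mem_ordIdeal U j)) (sub_truncTotal_mem_ordIdeal _ j)

end Comp

end HasTaylorSeries

theorem exists_hasTaylorSeries {u : EuclideanSpace 𝕜 ι → 𝕜} (hu : AnalyticAt 𝕜 u 0) :
    ∃ U, HasTaylorSeries u U := by
  obtain ⟨p, hp⟩ := hu
  choose Q hQ eval_Q using fun n => exists_polynomial_of_multilinear n (p n)
  let U : MvPowerSeries ι 𝕜 := fun d => (Q d.degree).coeff d
  refine ⟨U, HasTaylorSeries.of_forall_exists fun j =>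
    ⟨∑ n ∈ Finset.range j, Q n, ?_, mem_ordIdeal_iff_coeff.2 fun d hd => ?_⟩⟩
  · refine (hp.isBigO_sub_partialSum_pow j).congr_left fun x => ?_
    rw [zero_add, map_sum, FormalMultilinearSeries.partialSum]
    simp only [eval_Q]
  · have coeff_U : coeff d U = (Q d.degree).coeff d := rfl
    rw [map_sub, coeff_U, MvPolynomial.coeff_coe, MvPolynomial.coeff_sum,
      Finset.sum_eq_single d.degree (fun n _ hn => (hQ n).coeff_eq_zero hn.symm)
        fun h => absurd (Finset.mem_range.2 hd) h, sub_self]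

theorem eventually_eq_zero_of_hasTaylorSeries_zero {u : EuclideanSpace 𝕜 ι → 𝕜}
    (hu : AnalyticAt 𝕜 u 0) (h : HasTaylorSeries u 0) : u =ᶠ[𝓝 0] 0 := by
  obtain ⟨p, hp⟩ := hu
  have p_eq_zero : ∀ n x, (p n fun _ => x) = 0 := by
    intro n
    induction n using Nat.strong_induction_on with
    | _ n ih =>
      have partialSum_eq : ∀ x, p.partialSum (n + 1) x = p n fun _ => x := fun x =>
        (Finset.sum_range_succ _ _).trans <| by
          rw [Finset.sum_eq_zero fun m hm => ih m (Finset.mem_range.1 hm) x, zero_add]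
      have isBigO := (h.isBigO_iff.2 (zero_mem _)).sub (hp.isBigO_sub_partialSum_pow (n + 1))
      simp only [partialSum_eq, zero_add, sub_sub_cancel] at isBigO
      exact isBigO.continuousMultilinearMap_apply_eq_zero
  filter_upwards [hp.eventually_hasSum] with x hx
  simp only [zero_add, p_eq_zero] at hx
  exact hx.unique hasSum_zero

end TaylorSeries

section Germs

open Asymptotics

variable {ι : Type*} [Fintype ι]

theorem isBigO_of_mem_holFixing {E : Type*} [NormedAddCommGroup E] [NormedSpace ℂ E]
    (f : holFixing E) : (f.1 : E → E) =O[𝓝 0] fun x => x := by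
  simpa [f.2.2] using f.2.1.differentiableAt.isBigO_sub

theorem isBigO_sub_id_of_fderiv_eq_id {E : Type*} [NormedAddCommGroup E] [NormedSpace ℂ E]
    {f : holFixing E} (h : fderiv ℂ (f.1 : E → E) 0 = ContinuousLinearMap.id ℂ E) :
    (fun x => (f.1 : E → E) x - x) =O[𝓝 0] fun x => ‖x‖ ^ 2 := by
  obtain ⟨p, hp⟩ := f.2.1
  have p_one : ∀ x, (p 1 fun _ => x) = x := fun x => by
    simpa [h, Fin.snoc_zero] using (DFunLike.congr_fun hp.fderiv_eq x).symm
  have p_zero : ∀ x, (p 0 fun _ => x) = 0 := fun x => (hp.coeff_zero _).trans f.2.2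
  refine (hp.isBigO_sub_partialSum_pow 2).congr_left fun x => ?_
  rw [zero_add, FormalMultilinearSeries.partialSum, Finset.sum_range_succ, Finset.sum_range_one,
    p_zero, p_one, zero_add]

theorem analyticAt_apply {f : EuclideanSpace ℂ ι → EuclideanSpace ℂ ι} (hf : AnalyticAt ℂ f 0)
    (i : ι) : AnalyticAt ℂ (fun x => f x i) 0 :=
  ((EuclideanSpace.proj i : EuclideanSpace ℂ ι →L[ℂ] ℂ).analyticAt _).comp hf

theorem exists_taylorHom (f : holFixing (EuclideanSpace ℂ ι)) :
    ∃ σ : MvPowerSeries ι ℂ →ₐ[ℂ] MvPowerSeries ι ℂ,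
      ∀ i, HasTaylorSeries (fun x => f.1 x i) (σ (X i)) := by
  choose G hG using fun i => exists_hasTaylorSeries (analyticAt_apply f.2.1 i)
  have constantCoeff_G (i) : constantCoeff (G i) = 0 :=
    mem_ordIdeal_iff_coeff.1 ((hG i).mem_ordIdeal_one (isBigO_of_mem_holFixing f)) 0 (by simp)
  refine ⟨substAlgHom (hasSubst_of_constantCoeff_zero constantCoeff_G), fun i => ?_⟩
  rw [substAlgHom_X]
  exact hG i

/-- Substitution of the Taylor series of the coordinates of a holomorphic map fixing the origin, as
an endomorphism of the algebra of power series. -/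
def taylorHom (f : holFixing (EuclideanSpace ℂ ι)) : MvPowerSeries ι ℂ →ₐ[ℂ] MvPowerSeries ι ℂ :=
  (exists_taylorHom f).choose

variable {f g : holFixing (EuclideanSpace ℂ ι)}

theorem hasTaylorSeries_taylorHom_X (f : holFixing (EuclideanSpace ℂ ι)) (i : ι) :
    HasTaylorSeries (fun x => f.1 x i) (taylorHom f (X i)) :=
  (exists_taylorHom f).choose_spec i

theorem taylorHom_eq {σ : MvPowerSeries ι ℂ →ₐ[ℂ] MvPowerSeries ι ℂ}
    (h : ∀ i, HasTaylorSeries (fun x => f.1 x i) (σ (X i))) : taylorHom f = σ :=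
  algHom_ext_of_X
    (fun i => (hasTaylorSeries_taylorHom_X f i).mem_ordIdeal_one (isBigO_of_mem_holFixing f))
    fun i => (hasTaylorSeries_taylorHom_X f i).unique (h i)

theorem taylorHom_one : taylorHom (1 : holFixing (EuclideanSpace ℂ ι)) = 1 :=
  taylorHom_eq HasTaylorSeries.apply

theorem taylorHom_mul (f g : holFixing (EuclideanSpace ℂ ι)) :
    taylorHom (f * g) = taylorHom g * taylorHom f :=
  taylorHom_eq fun i => (hasTaylorSeries_taylorHom_X f i).comp (hasTaylorSeries_taylorHom_X g)
    (isBigO_of_mem_holFixing g)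

theorem taylorHom_eq_iff : taylorHom f = taylorHom g ↔ germCon _ f g := by
  refine ⟨fun h => ?_, fun h => taylorHom_eq fun i =>
    (hasTaylorSeries_taylorHom_X g i).congr (h.fun_comp (· i)).symm⟩
  have coord_eq (i) : (fun x => f.1 x i - g.1 x i) =ᶠ[𝓝 0] 0 := by
    have sub := (hasTaylorSeries_taylorHom_X f i).sub (hasTaylorSeries_taylorHom_X g i)
    rw [h, sub_self] at sub
    exact eventually_eq_zero_of_hasTaylorSeries_zero
      ((analyticAt_apply f.2.1 i).sub (analyticAt_apply g.2.1 i)) sub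
  filter_upwards [eventually_all.2 coord_eq] with x hx
  ext i
  exact sub_eq_zero.1 (hx i)

theorem taylorHom_X_sub_mem
    (h : fderiv ℂ (f.1 : EuclideanSpace ℂ ι → EuclideanSpace ℂ ι) 0 = ContinuousLinearMap.id ℂ _)
    (i : ι) : taylorHom f (X i) - X i ∈ ordIdeal ι ℂ 2 :=
  ((hasTaylorSeries_taylorHom_X f i).sub (HasTaylorSeries.apply i)).isBigO_iff.1 <|
    (isBigO_apply (fun x => (f.1 : EuclideanSpace ℂ ι → _) x - x) i).trans
      (isBigO_sub_id_of_fderiv_eq_id h)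

/-- The action of germs on power series by substitution of Taylor series; it reverses
composition. -/
def germTaylor : HolGerm (EuclideanSpace ℂ ι) →* (MvPowerSeries ι ℂ →ₐ[ℂ] MvPowerSeries ι ℂ)ᵐᵒᵖ :=
  (germCon _).lift
    { toFun := fun f => MulOpposite.op (taylorHom f)
      map_one' := congrArg MulOpposite.op taylorHom_one
      map_mul' := fun f g => congrArg MulOpposite.op (taylorHom_mul f g) }
    fun _ _ h => congrArg MulOpposite.op (taylorHom_eq_iff.2 h)

theorem germTaylor_injective : Function.Injective (germTaylor (ι := ι)) := fun a b => by
  induction a, b using Con.induction_on₂ with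
  | _ f g => exact fun h => (Con.eq _).2 (taylorHom_eq_iff.1 (MulOpposite.op_injective h))

/-- The action of germs of diffeomorphisms on power series by substitution of the Taylor series of
the inverse, the inverse making it a homomorphism. -/
def germAct : DiffGerm (EuclideanSpace ℂ ι) →* (MvPowerSeries ι ℂ ≃ₐ[ℂ] MvPowerSeries ι ℂ) :=
  (((AlgEquiv.algHomUnitsEquiv ℂ (MvPowerSeries ι ℂ) : _ →* _).comp
    (MulEquiv.inv' _).symm.toMonoidHom).comp Units.opEquiv.toMonoidHom).comp (Units.map germTaylor)

theorem germAct_injective : Function.Injective (germAct (ι := ι)) :=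
  (AlgEquiv.algHomUnitsEquiv _ _).injective.comp <| (MulEquiv.inv' _).symm.injective.comp <|
    Units.opEquiv.injective.comp (Units.map_injective germTaylor_injective)

theorem germAct_mem_unipotent {g : DiffGerm (EuclideanSpace ℂ ι)} (hg : g ∈ tangentToId _) :
    germAct g ∈ unipotent ι ℂ := by
  obtain ⟨f, hf⟩ := Con.mk'_surjective (c := germCon _) (g⁻¹).val
  have fderiv_f : fderiv ℂ (f.1 : EuclideanSpace ℂ ι → EuclideanSpace ℂ ι) 0 =
      ContinuousLinearMap.id ℂ _ := by
    have := congrArg Units.val (inv_mem hg : g⁻¹ ∈ tangentToId _)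
    rwa [Units.coe_map, ← hf] at this
  have germAct_apply : ∀ u, germAct g u = taylorHom f u := fun u =>
    congrArg (fun a => (germTaylor a).unop u) hf.symm
  intro j u hu
  rw [germAct_apply]
  exact sub_mem_ordIdeal_of_X (taylorHom_X_sub_mem fderiv_f) j u hu

theorem iterCommutator_closure_germ_eq_bot {S : Set (DiffGerm (EuclideanSpace ℂ (Fin 2)))}
    (hS : S ⊆ tangentToId (EuclideanSpace ℂ (Fin 2)))
    (h : iterCommutator (Subgroup.closure (conjCommutators S 8)) 4 = ⊥) :
    iterCommutator (Subgroup.closure S) 4 = ⊥ := by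
  let φ : tangentToId (EuclideanSpace ℂ (Fin 2)) →* unipotent (Fin 2) ℂ :=
    (germAct.comp (tangentToId _).subtype).codRestrict _ fun g => germAct_mem_unipotent g.2
  have φ_injective : Function.Injective φ := fun a b hab =>
    Subtype.ext (germAct_injective (congrArg Subtype.val hab))
  obtain ⟨T, rfl⟩ : ∃ T, (tangentToId _).subtype '' T = S :=
    Set.subset_range_iff_exists_image_eq.1 (by simpa using hS)
  rw [← image_conjCommutators, ← MonoidHom.map_closure, ← map_iterCommutator,
    Subgroup.map_eq_bot_iff_of_injective _ (tangentToId _).subtype_injective] at h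
  have image_eq_bot : iterCommutator (Subgroup.closure (φ '' T)) 4 = ⊥ :=
    iterCommutator_four_closure_eq_bot <| by
      rw [← image_conjCommutators, ← MonoidHom.map_closure, ← map_iterCommutator, h,
        Subgroup.map_bot]
  rw [← MonoidHom.map_closure, ← map_iterCommutator,
    Subgroup.map_eq_bot_iff_of_injective _ φ_injective] at image_eq_bot
  rw [← MonoidHom.map_closure, ← map_iterCommutator, image_eq_bot, Subgroup.map_bot]

end Germs

end FormalDiffeo

section CauchyEstimates

open Metric

variable {E F : Type*} [NormedAddCommGroup E] [NormedSpace ℂ E] [NormedAddCommGroup F]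
  [NormedSpace ℂ F] {c x y : E} {ρ ε τ : ℝ}

theorem norm_sub_le_of_forall_norm_le {a : E → F} (ha : DifferentiableOn ℂ a (ball c ρ))
    (hb : ∀ x ∈ ball c ρ, ‖a x‖ ≤ ε) (hτ : 0 < τ) (hx : x ∈ ball c (ρ - τ))
    (hy : y ∈ ball c (ρ - τ)) : ‖a y - a x‖ ≤ 2 * ε / τ * ‖y - x‖ := by
  have hsub : ∀ z ∈ ball c (ρ - τ), ball z τ ⊆ ball c ρ := fun z hz =>
    ball_subset_ball' (by linarith [mem_ball.1 hz])
  refine (convex_ball c (ρ - τ)).norm_image_sub_le_of_norm_fderiv_le (𝕜 := ℂ)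
    (fun z hz => ha.differentiableAt
      (mem_of_superset (ball_mem_nhds z hτ) (hsub z hz)))
    (fun z hz => Complex.norm_fderiv_le_div_of_mapsTo_ball (ha.mono (hsub z hz))
      (fun u hu => ?_) hτ) hx hy
  rw [mem_closedBall, dist_eq_norm]
  linarith [norm_sub_le (a u) (a z), hb u (hsub z hz hu),
    hb z (hsub z hz (mem_ball_self hτ))]

variable {s t : E → E}

theorem norm_map_sub_map_le_of_forall_norm_sub_le (hs : DifferentiableOn ℂ s (ball c ρ))
    (hsε : ∀ x ∈ ball c ρ, ‖s x - x‖ ≤ ε) (hτ : 0 < τ) (hετ : 2 * ε ≤ τ)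
    (hx : x ∈ ball c (ρ - τ)) (hy : y ∈ ball c (ρ - τ)) :
    ‖s y - s x‖ ≤ 2 * ‖y - x‖ := by
  have hdiff := norm_sub_le_of_forall_norm_le (hs.sub differentiableOn_id) hsε hτ hx hy
  have hlip : 2 * ε / τ * ‖y - x‖ ≤ 1 * ‖y - x‖ := by
    gcongr
    exact (div_le_one hτ).2 hετ
  calc ‖s y - s x‖ = ‖(s y - y - (s x - x)) + (y - x)‖ := by congr 1; abel
    _ ≤ ‖s y - y - (s x - x)‖ + ‖y - x‖ := norm_add_le _ _
    _ ≤ 2 * ‖y - x‖ := by simp only [Pi.sub_apply, id_eq] at hdiff; linarith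

-- `s t - t s` only involves the displacements of `s` and `t`, each of size `ε`, and each of them
-- is Lipschitz with constant `2 ε / τ`.
theorem norm_comp_sub_comp_le (hs : DifferentiableOn ℂ s (ball c ρ))
    (ht : DifferentiableOn ℂ t (ball c ρ)) (hsε : ∀ x ∈ ball c ρ, ‖s x - x‖ ≤ ε)
    (htε : ∀ x ∈ ball c ρ, ‖t x - x‖ ≤ ε) (hτ : 0 < τ) (hx : x ∈ ball c (ρ - τ))
    (hsx : s x ∈ ball c (ρ - τ)) (htx : t x ∈ ball c (ρ - τ)) :
    ‖s (t x) - t (s x)‖ ≤ 4 * ε ^ 2 / τ := by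
  have hxρ : x ∈ ball c ρ := ball_subset_ball (by linarith) hx
  have hε : 0 ≤ ε := (norm_nonneg _).trans (hsε x hxρ)
  have hs' := norm_sub_le_of_forall_norm_le (hs.sub differentiableOn_id) hsε hτ hx htx
  have ht' := norm_sub_le_of_forall_norm_le (ht.sub differentiableOn_id) htε hτ hx hsx
  simp only [Pi.sub_apply, id_eq] at hs' ht'
  calc ‖s (t x) - t (s x)‖
      = ‖(s (t x) - t x - (s x - x)) - (t (s x) - s x - (t x - x))‖ := by congr 1; abel
    _ ≤ 2 * ε / τ * ‖t x - x‖ + 2 * ε / τ * ‖s x - x‖ :=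
      (norm_sub_le _ _).trans (add_le_add hs' ht')
    _ ≤ 2 * ε / τ * ε + 2 * ε / τ * ε := by gcongr <;> solve_by_elim
    _ = 4 * ε ^ 2 / τ := by ring

theorem mem_ball_of_mem_ball_of_norm_sub_le {E : Type*} [SeminormedAddCommGroup E] {c x y : E}
    {ρ ε : ℝ} (hx : x ∈ ball c ρ) (h : ‖y - x‖ ≤ ε) : y ∈ ball c (ρ + ε) := by
  rw [mem_ball] at hx ⊢
  linarith [dist_triangle y x c, (dist_eq_norm y x).trans_le h]

end CauchyEstimates

theorem exists_eventuallyEq_of_forall_eventually_eq {X Y : Type*} [TopologicalSpace X]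
    [BaireSpace X] [TopologicalSpace Y] [T2Space Y] {U : Set X} (hU : IsOpen U) (hne : U.Nonempty)
    {f : ℕ → X → Y} {g : X → Y} (hf : ∀ n, ContinuousOn (f n) U) (hg : ContinuousOn g U)
    (h : ∀ x ∈ U, ∀ᶠ n in atTop, f n x = g x) : ∃ q ∈ U, ∃ n, f n =ᶠ[𝓝 q] g := by
  have := hU.baireSpace
  have := hne.to_subtype
  obtain ⟨n, x, hx⟩ := nonempty_interior_of_iUnion_of_closed
    (f := fun N => {x : U | ∀ n ≥ N, f n x = g x})
    (fun N => by
      simp only [Set.ofPred_forall]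
      exact isClosed_iInter fun n => isClosed_iInter fun _ =>
        isClosed_eq (hf n).domRestrict hg.domRestrict)
    (Set.eq_univ_of_forall fun x => Set.mem_iUnion.2 (eventually_atTop.1 (h x x.2)))
  refine ⟨x, x.2, n, ?_⟩
  rw [EventuallyEq, ← hU.isOpenEmbedding_subtypeVal.map_nhds_eq x, eventually_map]
  filter_upwards [mem_interior_iff_mem_nhds.1 hx] with y hy using hy n le_rfl

namespace Pseudogroup

open Metric

variable {E : Type*} [NormedAddCommGroup E] [NormedSpace ℂ E]

section Words

variable (P : Pseudogroup E)

theorem wordMap_append (w w' : List (Fin P.k × Bool)) (x : E) :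
    P.wordMap (w ++ w') x = P.wordMap w (P.wordMap w' x) := by
  induction w with
  | nil => rfl
  | cons a w ih => rw [List.cons_append, wordMap, ih, wordMap]

theorem dom_subset_V (w : List (Fin P.k × Bool)) : P.dom w ⊆ P.V := by
  induction w with
  | nil => exact subset_rfl
  | cons a w ih => exact fun x hx => ih hx.1

theorem mem_dom_append {w w' : List (Fin P.k × Bool)} {x : E} (hx : x ∈ P.dom w')
    (h : P.wordMap w' x ∈ P.dom w) : x ∈ P.dom (w ++ w') := by
  induction w with
  | nil => exact hx
  | cons a w ih => exact ⟨ih h.1, (P.wordMap_append w w' x).symm ▸ h.2⟩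

theorem letter_zero (a : Fin P.k × Bool) : P.letter a 0 = 0 := by
  unfold letter
  split_ifs
  exacts [(P.gen a.1).map_zero, (P.gen a.1).inv_zero]

theorem analyticAt_letter (a : Fin P.k × Bool) {x : E} (hx : x ∈ P.V) :
    AnalyticAt ℂ (P.letter a) x := by
  unfold letter
  split_ifs
  exacts [(P.gen a.1).holo x (P.subset_source _ hx), (P.gen a.1).holo_symm x (P.subset_target _ hx)]

theorem wordMap_zero (w : List (Fin P.k × Bool)) : P.wordMap w 0 = 0 := by
  induction w with
  | nil => rfl
  | cons a w ih => rw [wordMap, ih, letter_zero]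

theorem zero_mem_dom (w : List (Fin P.k × Bool)) : (0 : E) ∈ P.dom w := by
  induction w with
  | nil => exact P.zero_mem
  | cons _ w ih => exact ⟨ih, (P.wordMap_zero w).symm ▸ P.zero_mem⟩

theorem analyticOnNhd_wordMap (w : List (Fin P.k × Bool)) :
    AnalyticOnNhd ℂ (P.wordMap w) (P.dom w) := by
  induction w with
  | nil => exact fun x _ => analyticAt_id
  | cons a w ih =>
    exact fun x hx => AnalyticAt.fun_comp (g := P.letter a) (P.analyticAt_letter a hx.2) (ih x hx.1)

/-- The germ at the origin of a letter. -/
def letterGerm (a : Fin P.k × Bool) : DiffGerm E :=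
  if a.2 then (P.gen a.1).germ else (P.gen a.1).germ⁻¹

/-- The germ at the origin of the map attached to a word. -/
def wordGerm (w : List (Fin P.k × Bool)) : DiffGerm E := (w.map P.letterGerm).prod

theorem wordGerm_append (w w' : List (Fin P.k × Bool)) :
    P.wordGerm (w ++ w') = P.wordGerm w * P.wordGerm w' := by
  rw [wordGerm, List.map_append, List.prod_append, wordGerm, wordGerm]

theorem wordGerm_val (w : List (Fin P.k × Bool)) :
    (P.wordGerm w).val = ((⟨P.wordMap w, P.analyticOnNhd_wordMap w 0 (P.zero_mem_dom w),
      P.wordMap_zero w⟩ : holFixing E) : HolGerm E) := by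
  induction w with
  | nil => rfl
  | cons a w ih =>
    have letterGerm_val : (P.letterGerm a).val = ((⟨P.letter a, P.analyticAt_letter a P.zero_mem,
        P.letter_zero a⟩ : holFixing E) : HolGerm E) := by
      obtain ⟨i, b⟩ := a
      cases b <;> rfl
    rw [wordGerm, List.map_cons, List.prod_cons, Units.val_mul, letterGerm_val, ← wordGerm, ih]
    rfl

theorem wordGerm_eq_one_iff {w : List (Fin P.k × Bool)} :
    P.wordGerm w = 1 ↔ P.wordMap w =ᶠ[𝓝 0] id := by
  rw [← Units.val_inj, wordGerm_val]
  exact Con.eq (germCon E)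

theorem fderiv_wordMap_zero (hP : P.group ≤ tangentToId E) {w : List (Fin P.k × Bool)} :
    fderiv ℂ (P.wordMap w) 0 = ContinuousLinearMap.id ℂ E := by
  have letterGerm_mem : ∀ a, P.letterGerm a ∈ P.group := fun a => by
    have hgen : (P.gen a.1).germ ∈ P.group := Subgroup.subset_closure ⟨a.1, rfl⟩
    unfold letterGerm
    split_ifs
    exacts [hgen, inv_mem hgen]
  have wordGerm_mem : P.wordGerm w ∈ P.group := list_prod_mem fun g hg => by
    obtain ⟨a, -, rfl⟩ := List.mem_map.1 hg
    exact letterGerm_mem a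
  have hder : Units.map (derivHom E) (P.wordGerm w) = 1 := hP wordGerm_mem
  rw [← Units.val_inj, Units.coe_map, wordGerm_val] at hder
  exact hder

theorem eventually_norm_letter_sub_le (hP : P.group ≤ tangentToId E) {c : ℝ} (hc : 0 < c)
    (a : Fin P.k × Bool) : ∀ᶠ x in 𝓝 (0 : E), ‖P.letter a x - x‖ ≤ c * ‖x‖ := by
  have hderiv := (P.analyticAt_letter a P.zero_mem).differentiableAt.hasFDerivAt
  have hid : fderiv ℂ (P.letter a) 0 = _ := P.fderiv_wordMap_zero hP (w := [a])
  rw [hid, hasFDerivAt_iff_isLittleO_nhds_zero] at hderiv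
  filter_upwards [hderiv.def hc] with x hx
  simpa only [zero_add, letter_zero, sub_zero, ContinuousLinearMap.id_apply] using hx

end Words

variable {P : Pseudogroup E} {ρ ρ' ε δ τ : ℝ} {s s' t t' w w' : List (Fin P.k × Bool)}
  {g h : DiffGerm E}

variable (P) in
/-- On the ball of radius `ρ` about the origin, the map of the word `w` is defined as an element of
the pseudogroup, moves no point by more than `ε`, and is undone by the map of the word `w'`. -/
structure NearId (ρ ε : ℝ) (w w' : List (Fin P.k × Bool)) : Prop where
  mem_dom : ∀ x ∈ ball (0 : E) ρ, x ∈ P.dom w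
  norm_sub_le : ∀ x ∈ ball (0 : E) ρ, ‖P.wordMap w x - x‖ ≤ ε
  leftInv : ∀ x ∈ ball (0 : E) ρ, P.wordMap w' (P.wordMap w x) = x

namespace NearId

theorem mono (h : P.NearId ρ ε w w') (hρ : ρ' ≤ ρ) (hε : ε ≤ δ) : P.NearId ρ' δ w w' where
  mem_dom x hx := h.mem_dom x (ball_subset_ball hρ hx)
  norm_sub_le x hx := (h.norm_sub_le x (ball_subset_ball hρ hx)).trans hε
  leftInv x hx := h.leftInv x (ball_subset_ball hρ hx)

theorem differentiableOn (h : P.NearId ρ ε w w') :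
    DifferentiableOn ℂ (P.wordMap w) (ball 0 ρ) :=
  ((P.analyticOnNhd_wordMap w).mono h.mem_dom).differentiableOn

theorem map_mem_ball (h : P.NearId ρ ε w w') (hρ : ρ' + ε ≤ δ) (hρ' : ρ' ≤ ρ) {x : E}
    (hx : x ∈ ball (0 : E) ρ') : P.wordMap w x ∈ ball (0 : E) δ :=
  ball_subset_ball hρ
    (mem_ball_of_mem_ball_of_norm_sub_le hx (h.norm_sub_le x (ball_subset_ball hρ' hx)))

theorem append (hs : P.NearId ρ ε s s') (ht : P.NearId ρ' δ t t') (h : ρ' + δ ≤ ρ) :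
    P.NearId ρ' (ε + δ) (s ++ t) (t' ++ s') := by
  have map_mem : ∀ x ∈ ball (0 : E) ρ', P.wordMap t x ∈ ball 0 ρ := fun x hx =>
    ht.map_mem_ball h le_rfl hx
  refine ⟨fun x hx => P.mem_dom_append (ht.mem_dom x hx) (hs.mem_dom _ (map_mem x hx)),
    fun x hx => ?_, fun x hx => ?_⟩
  · rw [wordMap_append]
    exact (norm_sub_le_norm_sub_add_norm_sub _ (P.wordMap t x) _).trans
      (add_le_add (hs.norm_sub_le _ (map_mem x hx)) (ht.norm_sub_le x hx))
  · rw [wordMap_append, wordMap_append, hs.leftInv _ (map_mem x hx), ht.leftInv x hx]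

theorem comm (hs : P.NearId ρ ε s s') (hs' : P.NearId ρ ε s' s) (ht : P.NearId ρ ε t t')
    (ht' : P.NearId ρ ε t' t) (hτ : 0 < τ) (hετ : 8 * ε ≤ τ) :
    P.NearId (ρ - τ) (16 * ε ^ 2 / τ) (s ++ (t ++ (s' ++ t'))) (t ++ (s ++ (t' ++ s'))) := by
  have h₁ := ht'.mono (ρ' := ρ - τ) (by linarith) le_rfl
  have h₂ := hs'.append h₁ (by linarith)
  have h₃ := ht.append h₂ (by linarith)
  have h₄ := hs.append h₃ (by linarith)
  simp only [List.append_assoc] at h₄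
  refine ⟨h₄.mem_dom, fun x hx => ?_, h₄.leftInv⟩
  set y := P.wordMap (s' ++ t') x with hy
  have hsy : P.wordMap s y = P.wordMap t' x := by
    rw [hy, wordMap_append, hs'.leftInv _ (h₁.map_mem_ball (by linarith) le_rfl hx)]
  have htsy : P.wordMap t (P.wordMap s y) = x := by
    rw [hsy, ht'.leftInv x (ball_subset_ball (by linarith) hx)]
  have hcomm := norm_comp_sub_comp_le (ρ := ρ) (τ := τ / 4) (x := y) hs.differentiableOn
    ht.differentiableOn hs.norm_sub_le ht.norm_sub_le (by linarith)
    (h₂.map_mem_ball (by linarith) le_rfl hx) (hsy ▸ h₁.map_mem_ball (by linarith) le_rfl hx)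
    (P.wordMap_append t _ x ▸ h₃.map_mem_ball (by linarith) le_rfl hx)
  rw [htsy] at hcomm
  rw [wordMap_append, wordMap_append]
  exact hcomm.trans_eq (by ring)

theorem conj (hs : P.NearId ρ ε s s') (hs' : P.NearId ρ ε s' s) (ht : P.NearId ρ' δ t t')
    (hρ : ρ' ≤ ρ) (hδ : δ ≤ ε) (hτ : 0 < τ) (hετ : 8 * ε ≤ τ) :
    P.NearId (ρ' - τ) (2 * δ) (s ++ (t ++ s')) (s ++ (t' ++ s')) := by
  have h₁ := hs'.mono (ρ' := ρ' - τ) (by linarith) le_rfl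
  have h₂ := (ht.mono (ρ' := ρ' - τ + ε) (by linarith) hδ).append h₁ le_rfl
  have h₃ := hs.append h₂ (by linarith)
  simp only [List.append_assoc] at h₃
  refine ⟨h₃.mem_dom, fun x hx => ?_, h₃.leftInv⟩
  have hs'x : P.wordMap s' x ∈ ball 0 (ρ - τ / 4) := h₁.map_mem_ball (by linarith) le_rfl hx
  have hlip := norm_map_sub_map_le_of_forall_norm_sub_le hs.differentiableOn hs.norm_sub_le
    (by linarith) (by linarith) hs'x
    (P.wordMap_append t _ x ▸ h₂.map_mem_ball (by linarith) le_rfl hx)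
  rw [hs'.leftInv x (ball_subset_ball (by linarith) hx)] at hlip
  rw [wordMap_append, wordMap_append]
  refine hlip.trans ?_
  gcongr
  exact ht.norm_sub_le _ (h₁.map_mem_ball (by linarith) le_rfl hx)

end NearId

variable (P) in
/-- The germ `g` is represented by a word whose map is within `ε` of the identity on the ball of
radius `ρ`, and so is `g⁻¹`, by a word undoing the first one on this ball and undone by it. -/
def IsClose (ρ ε : ℝ) (g : DiffGerm E) : Prop :=
  ∃ w w' : List (Fin P.k × Bool), P.wordGerm w = g ∧ P.wordGerm w' = g⁻¹ ∧
    P.NearId ρ ε w w' ∧ P.NearId ρ ε w' w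

namespace IsClose

open scoped commutatorElement

theorem mono (hg : P.IsClose ρ ε g) (hρ : ρ' ≤ ρ) (hε : ε ≤ δ) : P.IsClose ρ' δ g := by
  obtain ⟨w, w', hw, hw', hn, hn'⟩ := hg
  exact ⟨w, w', hw, hw', hn.mono hρ hε, hn'.mono hρ hε⟩

theorem comm (hg : P.IsClose ρ ε g) (hh : P.IsClose ρ ε h) (hτ : 0 < τ) (hετ : 8 * ε ≤ τ) :
    P.IsClose (ρ - τ) (16 * ε ^ 2 / τ) ⁅g, h⁆ := by
  obtain ⟨s, s', rfl, hs', hns, hns'⟩ := hg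
  obtain ⟨t, t', rfl, ht', hnt, hnt'⟩ := hh
  refine ⟨_, _, ?_, ?_, hns.comm hns' hnt hnt' hτ hετ, hnt.comm hnt' hns hns' hτ hετ⟩ <;>
  · simp only [wordGerm_append, hs', ht', commutatorElement_def]
    group

theorem conj (hg : P.IsClose ρ ε g) (hh : P.IsClose ρ' δ h) (hρ : ρ' ≤ ρ) (hδ : δ ≤ ε)
    (hτ : 0 < τ) (hετ : 8 * ε ≤ τ) : P.IsClose (ρ' - τ) (2 * δ) (g * h * g⁻¹) := by
  obtain ⟨s, s', rfl, hs', hns, hns'⟩ := hg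
  obtain ⟨t, t', rfl, ht', hnt, hnt'⟩ := hh
  refine ⟨_, _, ?_, ?_, hns.conj hns' hnt hρ hδ hτ hετ, hns.conj hns' hnt' hρ hδ hτ hετ⟩ <;>
  · simp only [wordGerm_append, hs', ht']
    group

end IsClose

variable {S : Set (DiffGerm E)}

theorem isClose_conjCommutators (hS : ∀ s ∈ S, P.IsClose ρ ε s) (hτ : 0 < τ) (hετ : 8 * ε ≤ τ)
    {n : ℕ} (hn : 2 ^ n * (16 * ε ^ 2 / τ) ≤ ε) :
    ∀ g ∈ conjCommutators S n,
      P.IsClose (ρ - (n + 1) * τ) (2 ^ n * (16 * ε ^ 2 / τ)) g := by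
  induction n with
  | zero =>
    rintro _ ⟨s, hs, t, ht, rfl⟩
    simpa using (hS s hs).comm (hS t ht) hτ hετ
  | succ n ih =>
    have hpow : (2 : ℝ) ^ n * (16 * ε ^ 2 / τ) ≤ 2 ^ (n + 1) * (16 * ε ^ 2 / τ) := by
      gcongr <;> norm_num
    have hρ : 0 ≤ (n + 1 : ℝ) * τ := by positivity
    rintro _ (hg | ⟨s, hs, x, hx, rfl⟩)
    · exact (ih (hpow.trans hn) _ hg).mono (by push_cast; linarith) hpow
    · exact ((hS s hs).conj (ih (hpow.trans hn) x hx) (by linarith) (hpow.trans hn) hτ hετ).mono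
        (by push_cast; linarith) (le_of_eq (by ring))

-- `8192 = 2 ^ 8 * 16 * 2` turns the bound `2 ^ 8 * (16 * ε ^ 2 / τ)` into `ε / 2`.
theorem isClose_conjCommutators_eight (hS : ∀ s ∈ S, P.IsClose ρ ε s) (hτ : 0 < τ) (hε : 0 ≤ ε)
    (hετ : 8192 * ε ≤ τ) : ∀ g ∈ conjCommutators S 8, P.IsClose (ρ - 9 * τ) (ε / 2) g := by
  have hhalf : 2 ^ 8 * (16 * ε ^ 2 / τ) ≤ ε / 2 := by
    rw [← mul_div_assoc, div_le_iff₀ hτ]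
    nlinarith
  exact fun g hg => (isClose_conjCommutators hS hτ (by linarith) (by linarith) g hg).mono
    (by norm_num) hhalf

-- The radii lost at the successive steps are `9 * τ = r / 4 / 2 ^ n`, and `294912 = 8192 * 36`.
theorem isClose_iterConjCommutators {r : ℝ} (hr : 0 < r)
    (hS : ∀ s ∈ S, P.IsClose r (r / 294912) s) (n : ℕ) :
    ∀ g ∈ iterConjCommutators S n, P.IsClose (r / 2 + r / 2 / 2 ^ n) (r / 294912 / 2 ^ n) g := by
  induction n with
  | zero => exact fun g hg => (hS g hg).mono (by norm_num) (by norm_num)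
  | succ n ih =>
    rw [iterConjCommutators, Function.iterate_succ_apply']
    refine fun g hg => (isClose_conjCommutators_eight (τ := r / 36 / 2 ^ n) ih (by positivity)
      (by positivity) (le_of_eq ?_) g hg).mono (le_of_eq ?_) (le_of_eq ?_) <;>
    · field_simp
      ring_nf

theorem exists_isClose_germ_gen (hP : P.group ≤ tangentToId E) {c : ℝ} (hc : 0 < c) :
    ∃ r, 0 < r ∧ ∀ i, P.IsClose r (c * r) (P.gen i).germ := by
  obtain ⟨r, hr, hball⟩ := eventually_nhds_iff_ball.1
    ((eventually_all.2 (P.eventually_norm_letter_sub_le hP hc)).and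
      (P.isOpen_V.mem_nhds P.zero_mem))
  have norm_letter_sub_le : ∀ a, ∀ x ∈ ball (0 : E) r, ‖P.letter a x - x‖ ≤ c * r :=
    fun a x hx => ((hball x hx).1 a).trans (by gcongr; exact (mem_ball_zero_iff.1 hx).le)
  refine ⟨r, hr, fun i => ⟨[(i, true)], [(i, false)], List.prod_singleton, List.prod_singleton,
    ⟨fun x hx => ?_, norm_letter_sub_le _, fun x hx => ?_⟩,
    ⟨fun x hx => ?_, norm_letter_sub_le _, fun x hx => ?_⟩⟩⟩
  · exact ⟨(hball x hx).2, (hball x hx).2⟩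
  · exact (P.gen i).left_inv' (P.subset_source i (hball x hx).2)
  · exact ⟨(hball x hx).2, (hball x hx).2⟩
  · exact (P.gen i).right_inv' (P.subset_target i (hball x hx).2)

section Orbits

theorem LocallyDiscreteAt.eventually_fixed {p : E} (hp : P.LocallyDiscreteAt p)
    {h : ℕ → List (Fin P.k × Bool)} (hdom : ∀ n, p ∈ P.dom (h n))
    (hlim : Tendsto (fun n => P.wordMap (h n) p) atTop (𝓝 p)) :
    ∀ᶠ n in atTop, P.wordMap (h n) p = p := by
  have hpV : p ∈ P.V := P.dom_subset_V _ (hdom 0)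
  obtain ⟨W, hW, hWp⟩ := hp p ⟨hpV, [], hpV, rfl⟩
  filter_upwards [hlim.eventually hW, hlim.eventually (P.isOpen_V.mem_nhds hpV)] with n hnW hnV
  have : P.wordMap (h n) p ∈ W ∩ P.orbit p := ⟨hnW, hnV, h n, hdom n, rfl⟩
  rwa [hWp] at this

theorem exists_not_locallyDiscreteAt [CompleteSpace E] {r : ℝ} (hr : 0 < r)
    {h : ℕ → List (Fin P.k × Bool)} (hdom : ∀ n, ball 0 r ⊆ P.dom (h n))
    (hne : ∀ n, ¬ P.wordMap (h n) =ᶠ[𝓝 0] id)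
    (hlim : TendstoUniformlyOn (fun n => P.wordMap (h n)) id atTop (ball 0 r)) :
    ∃ p ∈ ball (0 : E) r, ¬ P.LocallyDiscreteAt p := by
  by_contra! hall
  have analyticOnNhd : ∀ n, AnalyticOnNhd ℂ (P.wordMap (h n)) (ball 0 r) := fun n =>
    (P.analyticOnNhd_wordMap (h n)).mono (hdom n)
  obtain ⟨q, hq, N, hN⟩ := exists_eventuallyEq_of_forall_eventually_eq isOpen_ball
    ⟨0, mem_ball_self hr⟩ (fun n => (analyticOnNhd n).continuousOn) continuousOn_id
    fun p hp => (hall p hp).eventually_fixed (fun n => hdom n hp) (hlim.tendsto_at hp)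
  have eqOn := (analyticOnNhd N).eqOn_of_preconnected_of_eventuallyEq analyticOnNhd_id
    (convex_ball 0 r).isPreconnected hq hN
  exact hne N (eqOn.eventuallyEq_of_mem (ball_mem_nhds 0 hr))

end Orbits

end Pseudogroup

theorem exists_mem_iterConjCommutators_ne_one {S : Set (DiffGerm (EuclideanSpace ℂ (Fin 2)))}
    (hS : S ⊆ tangentToId (EuclideanSpace ℂ (Fin 2)))
    (hns : ¬ Group.IsSolvable (Subgroup.closure S)) (n : ℕ) :
    ∃ g ∈ iterConjCommutators S n, g ≠ 1 := by
  have not_solvable : iterCommutator (Subgroup.closure (iterConjCommutators S n)) 4 ≠ ⊥ := by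
    induction n with
    | zero => exact fun h => hns (isSolvable_of_iterCommutator_eq_bot h)
    | succ n ih =>
      rw [iterConjCommutators, Function.iterate_succ_apply']
      exact fun h => ih
        (FormalDiffeo.iterCommutator_closure_germ_eq_bot (iterConjCommutators_subset hS n) h)
  by_contra! hall
  refine not_solvable (le_bot_iff.1 ((iterCommutator_antitone _ (Nat.zero_le 4)).trans ?_))
  exact (Subgroup.closure_le _).2 hall

theorem exists_tendstoUniformlyOn_id (P : Pseudogroup (EuclideanSpace ℂ (Fin 2)))
    (hP : P.group ≤ tangentToId (EuclideanSpace ℂ (Fin 2)))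
    (hns : ¬ Group.IsSolvable P.group) :
    ∃ r : ℝ, 0 < r ∧ ∃ h : ℕ → List (Fin P.k × Bool),
      (∀ n, Metric.ball 0 r ⊆ P.dom (h n)) ∧ (∀ n, ¬ P.wordMap (h n) =ᶠ[𝓝 0] id) ∧
      TendstoUniformlyOn (fun n => P.wordMap (h n)) id atTop (Metric.ball 0 r) := by
  obtain ⟨r, hr, hgen⟩ := Pseudogroup.exists_isClose_germ_gen hP (c := 1 / 294912) (by norm_num)
  have isClose_gen : ∀ s ∈ Set.range fun i => (P.gen i).germ, P.IsClose r (r / 294912) s := by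
    rintro _ ⟨i, rfl⟩
    exact (hgen i).mono le_rfl (le_of_eq (by ring))
  have exists_word : ∀ n : ℕ, ∃ w, Metric.ball 0 (r / 2) ⊆ P.dom w ∧
      ¬ P.wordMap w =ᶠ[𝓝 0] id ∧
      ∀ x ∈ Metric.ball 0 (r / 2), ‖P.wordMap w x - x‖ ≤ r / 294912 / 2 ^ n := by
    intro n
    obtain ⟨g, hg, hg1⟩ :=
      exists_mem_iterConjCommutators_ne_one (Subgroup.subset_closure.trans hP) hns n
    obtain ⟨w, w', rfl, -, hw, -⟩ :=
      (Pseudogroup.isClose_iterConjCommutators hr isClose_gen n g hg).mono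
        (le_add_of_nonneg_right (by positivity : 0 ≤ r / 2 / 2 ^ n)) le_rfl
    exact ⟨w, hw.mem_dom, fun he => hg1 (P.wordGerm_eq_one_iff.2 he), hw.norm_sub_le⟩
  choose h hdom hne hclose using exists_word
  refine ⟨r / 2, half_pos hr, h, hdom, hne, Metric.tendstoUniformlyOn_iff.2 fun δ hδ => ?_⟩
  have bound_tendsto : Tendsto (fun n : ℕ => r / 294912 / 2 ^ n) atTop (𝓝 0) :=
    tendsto_const_nhds.div_atTop (tendsto_pow_atTop_atTop_of_one_lt one_lt_two)
  filter_upwards [bound_tendsto.eventually_lt_const hδ] with n hn x hx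
  rw [dist_comm, dist_eq_norm]
  exact (hclose n x hx).trans_lt hn

end LocalDyn

end

theorem mainTheorem7
    (G : Subgroup (LocalDyn.DiffGerm (EuclideanSpace ℂ (Fin 2)))) (hfg : G.FG)
    (hG : G ≤ LocalDyn.tangentToId (EuclideanSpace ℂ (Fin 2))) :
    (LocalDyn.HasLocallyDiscreteOrbits G → Group.IsSolvable G) ∧
    (¬ Group.IsSolvable G →
      ∀ P : LocalDyn.Pseudogroup (EuclideanSpace ℂ (Fin 2)), P.group = G →
        ∃ ε : ℝ, 0 < ε ∧
          (∃ h : ℕ → List (Fin P.k × Bool),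
            (∀ n, Metric.ball 0 ε ⊆ P.dom (h n)) ∧
            (∀ n, ¬ (P.wordMap (h n) =ᶠ[𝓝 0] id)) ∧
            TendstoUniformlyOn (fun n => P.wordMap (h n)) id atTop (Metric.ball 0 ε)) ∧
          ∃ p ∈ Metric.ball 0 ε, ¬ P.LocallyDiscreteAt p) := by
  refine ⟨fun ⟨P, hP, hdisc⟩ => ?_, ?_⟩
  · subst hP
    by_contra hns
    obtain ⟨r, hr, h, hdom, hne, hlim⟩ := LocalDyn.exists_tendstoUniformlyOn_id P hG hns
    obtain ⟨p, hp, hpd⟩ := LocalDyn.Pseudogroup.exists_not_locallyDiscreteAt hr hdom hne hlim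
    exact hpd (hdisc p (P.dom_subset_V _ (hdom 0 hp)))
  · rintro hns P rfl
    obtain ⟨r, hr, h, hdom, hne, hlim⟩ := LocalDyn.exists_tendstoUniformlyOn_id P hG hns
    exact ⟨r, hr, ⟨h, hdom, hne, hlim⟩,
      LocalDyn.Pseudogroup.exists_not_locallyDiscreteAt hr hdom hne hlim⟩
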